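/- Let $K$ be a commutative ring, let $\Lambda$ be the ring of symmetric functions over $K$ (symmetric formal power series of bounded degree in $x_1,x_2,\dots$ with coefficients in $K$), and let $\widehat\Lambda$ be its completion, the ring of all symmetric formal power series. Let $(\,,)\colon\widehat\Lambda\times\Lambda\to K$ be the Hall inner product, the pairing for which the Schur functions are orthonormal: if $F=\sum_\lambda A_\lambda s_\lambda\in\widehat\Lambda$ (possibly an infinite sum) and $f=\sum_\lambda B_\lambda s_\lambda\in\Lambda$ (a finite sum), then $(F,f)=\sum_\lambda A_\lambda B_\lambda$. Let $E(-1)=\sum_{i\ge 0}(-1)^i e_i\in\widehat\Lambda$, where $e_i$ is the $i$-th elementary symmetric function. For partitions $\mu\subset\lambda$, the dual stable Grothendieck polynomial is $g_{\lambda/\mu}=\sum_T x^T$, summed over the reverse plane partitions $T$ of shape $\lambda/\mu$ (fillings of the cells of $\lambda/\mu$ by positive integers that weakly increase along rows and columns), where $x^T=\prod_i x_i^{T(i)}$ and $T(i)$ is the number of columns of $T$ that contain $i$. Write $g_\lambda=g_{\lambda/\emptyset}$, and let $|\lambda/\mu|$ be the number of cells of $\lambda/\mu$. The skew shape $\lambda/\mu$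 is called a rook strip if every cell of $\lambda/\mu$ is a removable corner of $\lambda$. Then $g_{\lambda/\mu}\in\Lambda$ for all $\mu\subset\lambda$, and the following hold. 1. The map $(E(-1),-)\colon\Lambda\to K$ is a $K$-algebra homomorphism, and for all $\mu\subset\lambda$ $$(E(-1),g_{\lambda/\mu})=\begin{cases}(-1)^{|\lambda/\mu|}&\text{if }\lambda/\mu\text{ is a rook strip},\\0&\text{otherwise.}\end{cases}$$ In particular $(E(-1),g_\emptyset)=1$, $(E(-1),g_{(1)})=-1$, and $(E(-1),g_\lambda)=0$ whenever $|\lambda|>1$. 2. These values are those of the Möbius function $\mu_{\mathcal P}$ of Young's lattice (partitions ordered by inclusion): for all $\mu\subset\lambda$, the integer $\mu_{\mathcal P}(\mu,\lambda)$ is $(-1)^{|\lambda/\mu|}$ if $\lambda/\mu$ is a rook strip and $0$ otherwise, and $(E(-1),g_{\lambda/\mu})$ is the image of $\mu_{\mathcal P}(\mu,\lambda)$ in $K$. 3. There is exactly one $K$-linear map $I\colon\Lambda\to\Lambda$ with $I(g_\lambda)=\sum_{\mu\subset\lambda}g_\mu$ for all partitions $\lambda$; it is a $K$-algebra automorphism,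 and for all $\mu\subset\lambda$ $$I^{-1}(g_{\lambda/\mu})=\sum_{\substack{\mu\subset\nu\subset\lambda\\ \lambda/\nu\text{ rook strip}}}(-1)^{|\lambda/\nu|}g_{\nu/\mu}=\sum_{\substack{\mu\subset\nu\subset\lambda\\ \nu/\mu\text{ rook strip}}}(-1)^{|\nu/\mu|}g_{\lambda/\nu}.$$ -/

import Mathlib

/-! Symmetric functions in the variables `x 0, x 1, x 2, …` over a commutative ring `K`, realised
inside the ring of formal power series `MvPowerSeries ℕ K`. Tableau entries are natural numbers,
the entry `k` contributing the variable `x k`. -/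

noncomputable section

namespace SymFun

open MvPowerSeries

/-- The ring of symmetric formal power series (of possibly unbounded degree). -/
def Completed (K : Type*) [CommRing K] : Subalgebra K (MvPowerSeries ℕ K) where
  carrier := {F | ∀ σ : Equiv.Perm ℕ, renameEquiv (R := K) σ F = F}
  mul_mem' hF hG σ := by rw [map_mul, hF σ, hG σ]
  add_mem' hF hG σ := by rw [map_add, hF σ, hG σ]
  algebraMap_mem' r σ := (renameEquiv (R := K) σ).commutes r

/-- Symmetry in terms of coefficients. -/
theorem mem_completed_iff {K : Type*} [CommRing K] (F : MvPowerSeries ℕ K) :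
    F ∈ Completed K ↔
      ∀ (σ : Equiv.Perm ℕ) (d : ℕ →₀ ℕ), coeff (d.mapDomain σ) F = coeff d F := by
  have key : ∀ (σ : Equiv.Perm ℕ) (d : ℕ →₀ ℕ),
      coeff (d.mapDomain σ) (renameEquiv (R := K) σ F) = coeff d F := by
    intro σ d
    have h := coeff_embDomain_rename (R := K) (e := σ.toEmbedding) F d
    rw [Finsupp.embDomain_eq_mapDomain] at h
    exact h
  constructor
  · intro h σ d
    rw [← key σ d, h σ]
  · intro h σ
    ext d
    have h2 := key σ (d.mapDomain σ.symm)
    have h3 := h σ (d.mapDomain σ.symm)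
    have h4 : (d.mapDomain σ.symm).mapDomain σ = d := by
      rw [← Finsupp.mapDomain_comp]
      simp
    rw [h4] at h2 h3
    rw [h2, h3]

/-- The ring `Λ` of symmetric functions: symmetric formal power series of bounded degree. -/
def SymmFn (K : Type*) [CommRing K] : Subalgebra K (MvPowerSeries ℕ K) where
  carrier := {f | f ∈ Completed K ∧ ∃ N : ℕ, ∀ d : ℕ →₀ ℕ, N < d.degree → coeff d f = 0}
  mul_mem' := by
    classical
    rintro f g ⟨hf, N, hN⟩ ⟨hg, M, hM⟩
    refine ⟨mul_mem hf hg, N + M, fun d hd => ?_⟩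
    rw [coeff_mul]
    refine Finset.sum_eq_zero fun p hp => ?_
    have hp' : p.1 + p.2 = d := by simpa using hp
    rw [← hp', map_add] at hd
    rcases Nat.lt_or_ge N p.1.degree with h | h
    · rw [hN _ h, zero_mul]
    · rw [hM p.2 (by omega), mul_zero]
  add_mem' := by
    rintro f g ⟨hf, N, hN⟩ ⟨hg, M, hM⟩
    refine ⟨add_mem hf hg, max N M, fun d hd => ?_⟩
    rw [map_add, hN d (by omega), hM d (by omega), add_zero]
  algebraMap_mem' r := by
    classical
    refine ⟨(Completed K).algebraMap_mem r, 0, fun d hd => ?_⟩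
    rw [MvPowerSeries.algebraMap_apply, coeff_C, if_neg]
    rintro rfl
    simp at hd

/-! ### Schur functions and the Hall inner product -/

/-- The content of a semistandard tableau: the exponent vector of its monomial. -/
def content {lam : YoungDiagram} (T : SemistandardYoungTableau lam) : ℕ →₀ ℕ :=
  ∑ c ∈ lam.cells, Finsupp.single (T c.1 c.2) 1

/-- The Schur function `s_lam`, the generating function of semistandard tableaux: the coefficient
of `x ^ d` is the number of semistandard tableaux of shape `lam` and content `d`. -/
def schur (K : Type*) [CommRing K] (lam : YoungDiagram) : MvPowerSeries ℕ K :=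
  fun d => (Nat.card {T : SemistandardYoungTableau lam // content T = d} : K)

/-- `F = ∑ A lam • s_lam` as a formal, possibly infinite, linear combination of Schur functions
(for each monomial only the finitely many `lam` of the same size contribute). -/
def IsSchurExpansion {K : Type*} [CommRing K] (F : MvPowerSeries ℕ K) (A : YoungDiagram → K) :
    Prop :=
  ∀ d : ℕ →₀ ℕ, coeff d F = ∑ᶠ lam : YoungDiagram, A lam * coeff d (schur K lam)

open Classical in
/-- The coefficients of a symmetric formal power series in its expansion into Schur functions
(such an expansion exists and is unique). -/
def schurCoeff {K : Type*} [CommRing K] (F : Completed K) : YoungDiagram → K :=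
  if h : ∃ A, IsSchurExpansion (F : MvPowerSeries ℕ K) A then h.choose else 0

/-- The Hall inner product, for which the Schur functions are orthonormal, extended to pairs of
a symmetric formal power series and a symmetric function. The sum is finite since the second
argument is a finite combination of Schur functions. -/
def hall {K : Type*} [CommRing K] (F : Completed K) (f : SymmFn K) : K :=
  ∑ᶠ lam : YoungDiagram, schurCoeff F lam * schurCoeff ⟨f, f.2.1⟩ lam

/-! ### Elementary symmetric functions -/

open Classical in
/-- The elementary symmetric function `e_i`: the sum of all squarefree monomials of degree `i`. -/
def elem (K : Type*) [CommRing K] (i : ℕ) : MvPowerSeries ℕ K :=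
  fun d => if d.degree = i ∧ ∀ k, d k ≤ 1 then 1 else 0

/-- The series `∑ i, t ^ i • e_i`. -/
def elemSeries {K : Type*} [CommRing K] (t : K) : MvPowerSeries ℕ K :=
  fun d => ∑ᶠ i : ℕ, t ^ i * coeff d (elem K i)

open Classical in
theorem elemSeries_mem {K : Type*} [CommRing K] (t : K) : elemSeries t ∈ Completed K := by
  rw [mem_completed_iff]
  intro σ d
  have h1 : (d.mapDomain σ).degree = d.degree := by
    rw [Finsupp.degree_mapDomain]
  have h2 : (∀ k, (d.mapDomain σ) k ≤ 1) ↔ ∀ k, d k ≤ 1 := by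
    constructor
    · intro h k
      have := h (σ k)
      rwa [Finsupp.mapDomain_apply σ.injective] at this
    · intro h k
      rw [← σ.apply_symm_apply k, Finsupp.mapDomain_apply σ.injective]
      exact h _
  have h3 : ∀ i, coeff (d.mapDomain σ) (elem K i) = coeff d (elem K i) := by
    intro i
    change (if (d.mapDomain σ).degree = i ∧ ∀ k, (d.mapDomain σ) k ≤ 1 then (1 : K) else 0) =
      if d.degree = i ∧ ∀ k, d k ≤ 1 then 1 else 0
    simp only [h1, h2]
  change ∑ᶠ i : ℕ, t ^ i * coeff (d.mapDomain σ) (elem K i) =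
    ∑ᶠ i : ℕ, t ^ i * coeff d (elem K i)
  simp only [h3]

/-- `E(t) = ∑ i, t ^ i • e_i` as a symmetric formal power series. -/
def E {K : Type*} [CommRing K] (t : K) : Completed K := ⟨elemSeries t, elemSeries_mem t⟩

/-! ### Skew shapes, reverse plane partitions, dual stable Grothendieck polynomials -/

/-- The set of cells of the skew shape `lam / mu` (used when `mu ≤ lam`). -/
def skewCells (lam mu : YoungDiagram) : Finset (ℕ × ℕ) := lam.cells \ mu.cells

/-- A reverse plane partition of shape `lam / mu`: a filling of the cells whose rows and columns
are weakly increasing. As for `SemistandardYoungTableau`, it is a function on all of `ℕ × ℕ` that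
vanishes outside the shape. -/
@[ext]
structure ReversePlanePartition (lam mu : YoungDiagram) where
  entry : ℕ → ℕ → ℕ
  row_weak : ∀ {i j₁ j₂ : ℕ}, j₁ < j₂ → (i, j₁) ∈ skewCells lam mu → (i, j₂) ∈ skewCells lam mu →
    entry i j₁ ≤ entry i j₂
  col_weak : ∀ {i₁ i₂ j : ℕ}, i₁ < i₂ → (i₁, j) ∈ skewCells lam mu → (i₂, j) ∈ skewCells lam mu →
    entry i₁ j ≤ entry i₂ j
  zeros : ∀ {i j : ℕ}, (i, j) ∉ skewCells lam mu → entry i j = 0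

/-- The weight of a reverse plane partition `T`: its value at `k` is the number of columns of `T`
that contain the entry `k` (the sum runs over the distinct pairs of an entry and a column
containing it). -/
def ReversePlanePartition.weight {lam mu : YoungDiagram} (T : ReversePlanePartition lam mu) :
    ℕ →₀ ℕ :=
  ∑ p ∈ (skewCells lam mu).image (fun c => (T.entry c.1 c.2, c.2)), Finsupp.single p.1 1

/-- The dual stable Grothendieck polynomial `g_{lam/mu}`: the coefficient of `x ^ d` is the number
of reverse plane partitions of shape `lam / mu` and weight `d`. -/
def dualGrothendieck (K : Type*) [CommRing K] (lam mu : YoungDiagram) : MvPowerSeries ℕ K :=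
  fun d => (Nat.card {T : ReversePlanePartition lam mu // T.weight = d} : K)

/-- `lam / mu` is a rook strip: every cell of `lam / mu` is a removable corner of `lam`, that is,
neither the cell below it nor the cell to its right belongs to `lam`. -/
def IsRookStrip (lam mu : YoungDiagram) : Prop :=
  ∀ c ∈ skewCells lam mu, (c.1 + 1, c.2) ∉ lam ∧ (c.1, c.2 + 1) ∉ lam

/-! ### Young's lattice -/

/-- Intervals of Young's lattice (Young diagrams ordered by inclusion) are finite. -/
instance instLocallyFiniteOrderYoung : LocallyFiniteOrder YoungDiagram :=
  LocallyFiniteOrder.ofFiniteIcc fun a b => by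
    refine Set.Finite.of_finite_image (f := YoungDiagram.cells)
      ((b.cells.powerset.finite_toSet).subset ?_) ?_
    · rintro _ ⟨x, hx, rfl⟩
      exact Finset.mem_coe.2 (Finset.mem_powerset.2 (YoungDiagram.cells_subset_iff.2 hx.2))
    · intro x _ y _ h
      exact YoungDiagram.ext h

end SymFun

end

/-! In a reverse plane partition of shape `lam / mu` the cells with entry `n` form a skew shape,
contributing `x n` to the power of its number of nonempty columns. Hence the coefficient of `x ^ d`
in `g_{lam/mu}` is the `(mu, lam)` entry of a product of transfer operators `colOp (d n)` in the
incidence algebra of Young's lattice, where `colOp k` marks the skew shapes with exactly `k`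
nonempty columns. These operators commute, by induction on the number of columns, which gives the
symmetry of `g_{lam/mu}`.

The automorphism `I` adjoins one more variable and sets it to `1`. It is therefore a homomorphism
of algebras, and it is bijective because it differs from the identity by terms of lower degree.
The new variable may be used for the largest or for the smallest entries, so that `I g_{lam/mu}`
is both the sum of the `g_{nu/mu}` and the sum of the `g_{lam/nu}` over `mu ≤ nu ≤ lam`.
By the branching rule for Schur functions, `(E(-1), I s_lam)` is an alternating sum over the
vertical strips `nu ≤ lam` with `lam / nu` a horizontal strip, which cancels unless `lam` is empty:
thus `(E(-1), I f)` is the constant coefficient of `f`. Everything else is Möbius inversion in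
Young's lattice, whose Möbius function is computed by Boolean cancellation over sets of removable
corners. -/

noncomputable section

namespace SymFun

open MvPowerSeries

/-! ### Columns of Young diagrams -/

theorem colLen_eq_of_forall_mem_iff {nu : YoungDiagram} {j k : ℕ}
    (h : ∀ i, (i, j) ∈ nu ↔ i < k) : nu.colLen j = k :=
  eq_of_forall_lt_iff fun i => YoungDiagram.mem_iff_lt_colLen.symm.trans (h i)

theorem le_iff_colLen_le {mu nu : YoungDiagram} : mu ≤ nu ↔ ∀ j, mu.colLen j ≤ nu.colLen j := by
  refine ⟨fun h j => le_of_not_gt fun hj => ?_, fun h ⟨i, j⟩ hij => ?_⟩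
  · exact lt_irrefl _ (YoungDiagram.mem_iff_lt_colLen.1 (h (YoungDiagram.mem_iff_lt_colLen.2 hj)))
  · exact YoungDiagram.mem_iff_lt_colLen.2 ((YoungDiagram.mem_iff_lt_colLen.1 hij).trans_le (h j))

@[simp]
theorem colLen_bot (j : ℕ) : (⊥ : YoungDiagram).colLen j = 0 :=
  colLen_eq_of_forall_mem_iff (by simp)

/-- The Young diagram obtained by deleting the first column. -/
def dropCol (nu : YoungDiagram) : YoungDiagram where
  cells := nu.cells.preimage (Prod.map id Nat.succ)
    (Function.Injective.prodMap Function.injective_id Nat.succ_injective).injOn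
  isLowerSet := by
    rintro ⟨a, b⟩ ⟨c, d⟩ h hc
    rw [Finset.mem_coe, Finset.mem_preimage] at hc ⊢
    exact nu.up_left_mem h.1 (Nat.succ_le_succ h.2) hc

@[simp]
theorem mem_dropCol {nu : YoungDiagram} {i j : ℕ} : (i, j) ∈ dropCol nu ↔ (i, j + 1) ∈ nu := by
  rw [← YoungDiagram.mem_cells, ← YoungDiagram.mem_cells, dropCol, Finset.mem_preimage]
  rfl

@[simp]
theorem colLen_dropCol (nu : YoungDiagram) (j : ℕ) : (dropCol nu).colLen j = nu.colLen (j + 1) :=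
  colLen_eq_of_forall_mem_iff fun i => by rw [mem_dropCol, YoungDiagram.mem_iff_lt_colLen]

theorem colLen_zero_dropCol_le (nu : YoungDiagram) : (dropCol nu).colLen 0 ≤ nu.colLen 0 :=
  (colLen_dropCol nu 0).trans_le (nu.colLen_anti 0 1 zero_le_one)

/-- The Young diagram with first column of length `k` and the columns of `nu` to its right. -/
def consCol (k : ℕ) (nu : YoungDiagram) (h : nu.colLen 0 ≤ k) : YoungDiagram where
  cells := (Finset.range k).image (fun i => (i, 0)) ∪ nu.cells.image (fun c => (c.1, c.2 + 1))
  isLowerSet := by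
    rintro ⟨a, b⟩ ⟨c, d⟩ hle hc
    obtain ⟨hca, hdb⟩ : c ≤ a ∧ d ≤ b := hle
    simp only [Finset.coe_union, Set.mem_union, Finset.mem_coe, Finset.mem_image, Finset.mem_range,
      Prod.mk.injEq, YoungDiagram.mem_cells, Prod.exists] at hc ⊢
    rcases hc with ⟨i, hi, rfl, rfl⟩ | ⟨i, j, hij, rfl, rfl⟩
    · exact Or.inl ⟨c, by omega, rfl, by omega⟩
    · rcases d with _ | d
      · have hi := YoungDiagram.mem_iff_lt_colLen.1 (nu.up_left_mem le_rfl (Nat.zero_le _) hij)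
        exact Or.inl ⟨c, by omega, rfl, rfl⟩
      · exact Or.inr ⟨c, d, nu.up_left_mem hca (by omega) hij, rfl, rfl⟩

@[simp]
theorem colLen_consCol_zero {k : ℕ} {nu : YoungDiagram} {h : nu.colLen 0 ≤ k} :
    (consCol k nu h).colLen 0 = k :=
  colLen_eq_of_forall_mem_iff fun i => by simp [← YoungDiagram.mem_cells, consCol]

@[simp]
theorem dropCol_consCol {k : ℕ} {nu : YoungDiagram} {h : nu.colLen 0 ≤ k} :
    dropCol (consCol k nu h) = nu := by
  refine SetLike.ext fun ⟨i, j⟩ => ?_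
  rw [mem_dropCol, ← YoungDiagram.mem_cells]
  simp [consCol]

theorem le_iff_colLen_zero_le_and_dropCol_le {mu nu : YoungDiagram} :
    mu ≤ nu ↔ mu.colLen 0 ≤ nu.colLen 0 ∧ dropCol mu ≤ dropCol nu := by
  simp only [le_iff_colLen_le, colLen_dropCol]
  exact (Nat.and_forall_add_one (p := fun j => mu.colLen j ≤ nu.colLen j)).symm

theorem eq_iff_colLen_zero_eq_and_dropCol_eq {mu nu : YoungDiagram} :
    mu = nu ↔ mu.colLen 0 = nu.colLen 0 ∧ dropCol mu = dropCol nu := by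
  simp only [le_antisymm_iff, le_iff_colLen_zero_le_and_dropCol_le (mu := mu),
    le_iff_colLen_zero_le_and_dropCol_le (mu := nu)]
  tauto

@[gcongr]
theorem dropCol_mono {mu nu : YoungDiagram} (h : mu ≤ nu) : dropCol mu ≤ dropCol nu :=
  (le_iff_colLen_zero_le_and_dropCol_le.1 h).2

theorem le_consCol_iff {k : ℕ} {mu nu : YoungDiagram} {h : nu.colLen 0 ≤ k} :
    mu ≤ consCol k nu h ↔ mu.colLen 0 ≤ k ∧ dropCol mu ≤ nu := by
  rw [le_iff_colLen_zero_le_and_dropCol_le, colLen_consCol_zero, dropCol_consCol]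

theorem consCol_le_iff {k : ℕ} {mu nu : YoungDiagram} {h : nu.colLen 0 ≤ k} :
    consCol k nu h ≤ mu ↔ k ≤ mu.colLen 0 ∧ nu ≤ dropCol mu := by
  rw [le_iff_colLen_zero_le_and_dropCol_le, colLen_consCol_zero, dropCol_consCol]

theorem consCol_dropCol {k : ℕ} {nu : YoungDiagram} {h : (dropCol nu).colLen 0 ≤ k}
    (hk : nu.colLen 0 = k) : consCol k (dropCol nu) h = nu :=
  eq_iff_colLen_zero_eq_and_dropCol_eq.2 ⟨colLen_consCol_zero.trans hk.symm, dropCol_consCol⟩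

theorem colLen_zero_pos {nu : YoungDiagram} (h : nu ≠ ⊥) : 0 < nu.colLen 0 := by
  contrapose! h
  refine le_bot_iff.1 (le_iff_colLen_le.2 fun j => ?_)
  exact (nu.colLen_anti 0 j j.zero_le).trans (h.trans (Nat.zero_le _))

theorem card_eq_colLen_zero_add_card_dropCol (nu : YoungDiagram) :
    nu.card = nu.colLen 0 + (dropCol nu).card := by
  have hcol : nu.cells.filter (fun c => c.2 = 0) = nu.col 0 := rfl
  have hrest : nu.cells.filter (fun c => ¬ c.2 = 0) =
      (dropCol nu).cells.map
        ((Function.Embedding.refl ℕ).prodMap ⟨Nat.succ, Nat.succ_injective⟩) := by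
    ext ⟨i, _ | j⟩ <;> simp
  rw [YoungDiagram.card, ← Finset.card_filter_add_card_filter_not (fun c : ℕ × ℕ => c.2 = 0), hcol,
    hrest, Finset.card_map, YoungDiagram.colLen_eq_card]

theorem card_dropCol_lt {nu : YoungDiagram} (h : nu ≠ ⊥) : (dropCol nu).card < nu.card := by
  have := colLen_zero_pos h
  have := card_eq_colLen_zero_add_card_dropCol nu
  omega

/-- The number of nonempty columns of a skew shape. -/
def numCols (lam mu : YoungDiagram) : ℕ := ((skewCells lam mu).image Prod.snd).card

@[simp]
theorem mem_skewCells {lam mu : YoungDiagram} {c : ℕ × ℕ} :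
    c ∈ skewCells lam mu ↔ c ∈ lam ∧ c ∉ mu := by
  simp [skewCells]

theorem mem_image_snd_skewCells {lam mu : YoungDiagram} {j : ℕ} :
    j ∈ (skewCells lam mu).image Prod.snd ↔ mu.colLen j < lam.colLen j := by
  simp only [Finset.mem_image, mem_skewCells, Prod.exists, exists_eq_right,
    YoungDiagram.mem_iff_lt_colLen]
  exact ⟨fun ⟨_, hlam, hmu⟩ => (not_lt.1 hmu).trans_lt hlam, fun h => ⟨_, h, lt_irrefl _⟩⟩

theorem numCols_eq_add_numCols_dropCol (lam mu : YoungDiagram) :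
    numCols lam mu = (if mu.colLen 0 < lam.colLen 0 then 1 else 0) +
      numCols (dropCol lam) (dropCol mu) := by
  have h : (skewCells lam mu).image Prod.snd = (if mu.colLen 0 < lam.colLen 0 then {0} else ∅) ∪
      ((skewCells (dropCol lam) (dropCol mu)).image Prod.snd).map
        ⟨Nat.succ, Nat.succ_injective⟩ := by
    ext j
    rw [Finset.mem_union, mem_image_snd_skewCells]
    rcases j with _ | j
    · by_cases h : mu.colLen 0 < lam.colLen 0 <;> simp [h]
    · simp only [Finset.mem_map, mem_image_snd_skewCells, colLen_dropCol]
      split_ifs <;> simp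
  rw [numCols, h, Finset.card_union_of_disjoint (by split_ifs <;> simp), Finset.card_map]
  congr 1
  split_ifs <;> simp

theorem numCols_eq_zero_iff {lam mu : YoungDiagram} : numCols lam mu = 0 ↔ lam ≤ mu := by
  rw [numCols, Finset.card_eq_zero, Finset.image_eq_empty, skewCells,
    Finset.sdiff_eq_empty_iff_subset, YoungDiagram.cells_subset_iff]

/-! ### Symmetry of the column statistic on intervals -/

section Interval

variable {R : Type*} [CommRing R]

/-- The generating function of the interval from `mu` to `lam` in which each `nu` is marked by the
numbers of columns of `nu / mu` and `lam / nu`, restricted to those `nu` whose first column has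
length at most `n`. -/
def colGen (x y : R) (mu lam : YoungDiagram) (n : ℕ) : R :=
  ∑ nu ∈ Finset.Icc mu lam with nu.colLen 0 ≤ n, x ^ numCols nu mu * y ^ numCols lam nu

theorem colGen_of_colLen_zero_le (x y : R) {mu lam : YoungDiagram} {n : ℕ}
    (h : lam.colLen 0 ≤ n) :
    colGen x y mu lam n = ∑ nu ∈ Finset.Icc mu lam, x ^ numCols nu mu * y ^ numCols lam nu := by
  rw [colGen, Finset.filter_true_of_mem]
  intro nu hnu
  exact (le_iff_colLen_le.1 (Finset.mem_Icc.1 hnu).2 0).trans h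

theorem colGen_eq_colGen_colLen_zero (x y : R) {mu lam : YoungDiagram} {n : ℕ}
    (h : lam.colLen 0 ≤ n) : colGen x y mu lam n = colGen x y mu lam (lam.colLen 0) := by
  rw [colGen_of_colLen_zero_le x y h, colGen_of_colLen_zero_le x y le_rfl]

theorem sum_filter_colLen_zero_eq (x y : R) {mu lam : YoungDiagram} {k : ℕ}
    (hmu : mu.colLen 0 ≤ k) (hlam : k ≤ lam.colLen 0) :
    ∑ nu ∈ Finset.Icc mu lam with nu.colLen 0 = k, x ^ numCols nu mu * y ^ numCols lam nu =
      (if mu.colLen 0 < k then x else 1) * (if k < lam.colLen 0 then y else 1) *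
        colGen x y (dropCol mu) (dropCol lam) k := by
  rw [colGen, Finset.mul_sum]
  refine Finset.sum_bij' (fun nu _ => dropCol nu)
    (fun nu hnu => consCol k nu (Finset.mem_filter.1 hnu).2) ?_ ?_ ?_ ?_ ?_
  · intro nu hnu
    simp only [Finset.mem_filter, Finset.mem_Icc] at hnu ⊢
    exact ⟨⟨dropCol_mono hnu.1.1, dropCol_mono hnu.1.2⟩,
      (colLen_zero_dropCol_le nu).trans_eq hnu.2⟩
  · intro nu hnu
    simp only [Finset.mem_filter, Finset.mem_Icc] at hnu ⊢
    exact ⟨⟨le_consCol_iff.2 ⟨hmu, hnu.1.1⟩, consCol_le_iff.2 ⟨hlam, hnu.1.2⟩⟩,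
      colLen_consCol_zero⟩
  · exact fun nu hnu => consCol_dropCol (Finset.mem_filter.1 hnu).2
  · exact fun nu _ => dropCol_consCol
  · intro nu hnu
    rw [numCols_eq_add_numCols_dropCol nu mu, numCols_eq_add_numCols_dropCol lam nu,
      (Finset.mem_filter.1 hnu).2]
    split_ifs <;> ring

theorem colGen_colLen_zero (x y : R) {mu lam : YoungDiagram} (h : mu.colLen 0 ≤ lam.colLen 0) :
    colGen x y mu lam (mu.colLen 0) = (if mu.colLen 0 < lam.colLen 0 then y else 1) *
      colGen x y (dropCol mu) (dropCol lam) (mu.colLen 0) := by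
  have hfilter : (Finset.Icc mu lam).filter (fun nu => nu.colLen 0 ≤ mu.colLen 0) =
      (Finset.Icc mu lam).filter (fun nu => nu.colLen 0 = mu.colLen 0) :=
    Finset.filter_congr fun nu hnu =>
      (le_iff_colLen_le.1 (Finset.mem_Icc.1 hnu).1 0).ge_iff_eq'
  rw [colGen, hfilter, sum_filter_colLen_zero_eq x y le_rfl h, if_neg (lt_irrefl _), one_mul]

theorem colGen_add_one (x y : R) {mu lam : YoungDiagram} {n : ℕ}
    (hmu : mu.colLen 0 ≤ n) (hlam : n + 1 ≤ lam.colLen 0) :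
    colGen x y mu lam (n + 1) = colGen x y mu lam n +
      x * (if n + 1 < lam.colLen 0 then y else 1) *
        colGen x y (dropCol mu) (dropCol lam) (n + 1) := by
  classical
  have hsplit : (Finset.Icc mu lam).filter (fun nu => nu.colLen 0 ≤ n + 1) =
      (Finset.Icc mu lam).filter (fun nu => nu.colLen 0 ≤ n) ∪
        (Finset.Icc mu lam).filter (fun nu => nu.colLen 0 = n + 1) := by
    simp only [← Finset.filter_or, Nat.le_succ_iff]
  have hdisj : Disjoint ((Finset.Icc mu lam).filter fun nu => nu.colLen 0 ≤ n)
      ((Finset.Icc mu lam).filter fun nu => nu.colLen 0 = n + 1) :=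
    Finset.disjoint_filter.2 fun nu _ h => by omega
  rw [colGen, hsplit, Finset.sum_union hdisj, ← colGen,
    sum_filter_colLen_zero_eq x y (by omega) hlam, if_pos (Nat.lt_succ_of_le hmu)]

/-- The difference of two generating functions: those obtained from an interval with restricted
generating function `f` by adding in front of it a first column of the skew shape occupying the
rows from `a` to `a + 1`, respectively the row `a + 1` only. -/
def crossDiff (x y : R) (f : ℕ → R) (a : ℕ) : R := y * f a - y * f (a + 1) + x * y * f (a + 1)

section ColumnStep

variable {x y : R} {mu lam : YoungDiagram}
  (hcross : ∀ a, mu.colLen 0 ≤ a →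
    crossDiff x y (colGen x y (dropCol mu) (dropCol lam)) a =
      crossDiff y x (colGen y x (dropCol mu) (dropCol lam)) a)

include hcross

theorem colGen_sub_mul_colGen_dropCol_symm {n : ℕ} (hmu : mu.colLen 0 ≤ n)
    (hlam : n < lam.colLen 0) :
    colGen x y mu lam n - y * colGen x y (dropCol mu) (dropCol lam) n =
      colGen y x mu lam n - x * colGen y x (dropCol mu) (dropCol lam) n := by
  induction n, hmu using Nat.le_induction with
  | base => simp [colGen_colLen_zero _ _ hlam.le, hlam]
  | succ n hmu ih =>
    have hstep := hcross n hmu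
    simp only [crossDiff] at hstep
    rw [colGen_add_one x y hmu hlam.le, colGen_add_one y x hmu hlam.le, if_pos hlam, if_pos hlam]
    linear_combination ih (by omega) + hstep

variable (hsymm : colGen x y (dropCol mu) (dropCol lam) (lam.colLen 0) =
  colGen y x (dropCol mu) (dropCol lam) (lam.colLen 0))

include hsymm

theorem colGen_symm_of_dropCol (h : mu.colLen 0 ≤ lam.colLen 0) :
    colGen x y mu lam (lam.colLen 0) = colGen y x mu lam (lam.colLen 0) := by
  rcases h.eq_or_lt with heq | hlt
  · rw [← heq, colGen_colLen_zero _ _ h, colGen_colLen_zero _ _ h, heq, hsymm]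
    simp
  · obtain ⟨n, hn⟩ : ∃ n, lam.colLen 0 = n + 1 := ⟨lam.colLen 0 - 1, by omega⟩
    have hsub := colGen_sub_mul_colGen_dropCol_symm hcross (n := n) (by omega) (by omega)
    have hstep := hcross n (by omega)
    rw [hn] at hsymm ⊢
    simp only [crossDiff] at hstep
    rw [colGen_add_one x y (by omega) hn.ge, colGen_add_one y x (by omega) hn.ge, hn,
      if_neg (lt_irrefl _), if_neg (lt_irrefl _)]
    linear_combination hsub + hstep + (x + y - x * y) * hsymm

theorem crossDiff_colGen_symm_of_dropCol (h : mu.colLen 0 ≤ lam.colLen 0) {a : ℕ}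
    (ha : mu.colLen 0 ≤ a) :
    crossDiff x y (colGen x y mu lam) a = crossDiff y x (colGen y x mu lam) a := by
  have htop := colGen_symm_of_dropCol hcross hsymm h
  simp only [crossDiff]
  rcases lt_trichotomy (a + 1) (lam.colLen 0) with hlt | heq | hgt
  · have hsub := colGen_sub_mul_colGen_dropCol_symm hcross (n := a + 1) (by omega) hlt
    rw [colGen_add_one x y ha hlt.le, colGen_add_one y x ha hlt.le, if_pos hlt, if_pos hlt]
      at hsub ⊢
    linear_combination x * y * hsub
  · have hx := colGen_add_one x y ha heq.le
    have hy := colGen_add_one y x ha heq.le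
    rw [heq, if_neg (lt_irrefl _)] at hx hy
    rw [heq]
    linear_combination (-y) * hx + x * hy + (x * y) * htop - x * y * hsymm
  · have hconst (u v : R) (n : ℕ) (hn : lam.colLen 0 ≤ n) :=
      colGen_eq_colGen_colLen_zero (mu := mu) u v hn
    rw [hconst x y a (by omega), hconst x y (a + 1) (by omega), hconst y x a (by omega),
      hconst y x (a + 1) (by omega), htop]
    ring

end ColumnStep

/-- The claim on `crossDiff` strengthens the induction: it compares the same interval with one more
column in front of it. -/
theorem colGen_symm_and_crossDiff_colGen_symm (x y : R) {mu lam : YoungDiagram} (h : mu ≤ lam) :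
    (∀ n, lam.colLen 0 ≤ n → colGen x y mu lam n = colGen y x mu lam n) ∧
      ∀ a, mu.colLen 0 ≤ a →
        crossDiff x y (colGen x y mu lam) a = crossDiff y x (colGen y x mu lam) a := by
  induction hcard : lam.card using Nat.strong_induction_on generalizing mu lam with
  | _ N ih =>
    subst hcard
    rcases eq_or_ne lam ⊥ with rfl | hlam
    · obtain rfl := le_bot_iff.1 h
      have hone : ∀ (u v : R) (n : ℕ), colGen u v ⊥ ⊥ n = 1 := fun u v n => by
        rw [colGen_of_colLen_zero_le u v (by simp)]
        simp [numCols_eq_zero_iff.2 (le_refl (⊥ : YoungDiagram))]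
      simp [crossDiff, hone, mul_comm]
    · obtain ⟨hsymm, hcross⟩ := ih _ (card_dropCol_lt hlam) (dropCol_mono h) rfl
      have hcross' := fun a (ha : mu.colLen 0 ≤ a) =>
        hcross a ((colLen_zero_dropCol_le mu).trans ha)
      have hsymm' := hsymm _ (colLen_zero_dropCol_le lam)
      have hcol := le_iff_colLen_le.1 h 0
      refine ⟨fun n hn => ?_, fun a => crossDiff_colGen_symm_of_dropCol hcross' hsymm' hcol⟩
      rw [colGen_eq_colGen_colLen_zero x y hn, colGen_eq_colGen_colLen_zero y x hn]
      exact colGen_symm_of_dropCol hcross' hsymm' hcol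

theorem sum_Icc_pow_numCols_symm (x y : R) {mu lam : YoungDiagram} (h : mu ≤ lam) :
    ∑ nu ∈ Finset.Icc mu lam, x ^ numCols nu mu * y ^ numCols lam nu =
      ∑ nu ∈ Finset.Icc mu lam, y ^ numCols nu mu * x ^ numCols lam nu := by
  rw [← colGen_of_colLen_zero_le x y le_rfl, ← colGen_of_colLen_zero_le y x le_rfl]
  exact (colGen_symm_and_crossDiff_colGen_symm x y h).1 _ le_rfl

end Interval

/-! ### Transfer operators in the incidence algebra -/

section Transfer

open scoped IsMulCommutative

theorem card_filter_numCols_comm {mu lam : YoungDiagram} (h : mu ≤ lam) (a b : ℕ) :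
    ((Finset.Icc mu lam).filter fun nu => numCols nu mu = a ∧ numCols lam nu = b).card =
      ((Finset.Icc mu lam).filter fun nu => numCols nu mu = b ∧ numCols lam nu = a).card := by
  have hsymm := congrArg (MvPolynomial.coeff (Finsupp.single (0 : Fin 2) a + Finsupp.single 1 b))
    (sum_Icc_pow_numCols_symm (R := MvPolynomial (Fin 2) ℤ)
      (MvPolynomial.X 0) (MvPolynomial.X 1) h)
  have hcoeff (p q : ℕ) : MvPolynomial.coeff (Finsupp.single (0 : Fin 2) a + Finsupp.single 1 b)
      (MvPolynomial.X 0 ^ p * MvPolynomial.X 1 ^ q : MvPolynomial (Fin 2) ℤ) =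
        if p = a ∧ q = b then 1 else 0 := by
    rw [MvPolynomial.X_pow_eq_monomial, MvPolynomial.X_pow_eq_monomial,
      MvPolynomial.monomial_mul, one_mul, MvPolynomial.coeff_monomial]
    congr 1
    simp [Finsupp.ext_iff]
  simp only [MvPolynomial.coeff_sum, mul_comm (MvPolynomial.X 1 ^ _ : MvPolynomial (Fin 2) ℤ),
    hcoeff, Finset.sum_boole, Nat.cast_inj] at hsymm
  rw [hsymm]
  simp only [and_comm]

open Classical in
/-- The element of the incidence algebra of Young's lattice marking the intervals whose skew shape
has exactly `k` nonempty columns. -/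
def colOp (k : ℕ) : IncidenceAlgebra ℕ YoungDiagram where
  toFun mu lam := if mu ≤ lam ∧ numCols lam mu = k then 1 else 0
  eq_zero_of_not_le' _ _ h := if_neg fun hle => h hle.1

open Classical in
theorem colOp_apply {k : ℕ} {mu lam : YoungDiagram} (h : mu ≤ lam) :
    colOp k mu lam = if numCols lam mu = k then 1 else 0 := by
  change (if mu ≤ lam ∧ numCols lam mu = k then 1 else 0) = _
  simp [h]

open Classical in
theorem colOp_zero : colOp 0 = 1 := by
  ext mu lam h
  simp only [colOp_apply h, IncidenceAlgebra.one_apply, numCols_eq_zero_iff, h.ge_iff_eq]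

theorem colOp_mul_colOp_apply {mu lam : YoungDiagram} (a b : ℕ) :
    (colOp a * colOp b) mu lam =
      ((Finset.Icc mu lam).filter fun nu => numCols nu mu = a ∧ numCols lam nu = b).card := by
  rw [IncidenceAlgebra.mul_apply, Finset.card_filter]
  refine Finset.sum_congr rfl fun nu hnu => ?_
  rw [Finset.mem_Icc] at hnu
  rw [colOp_apply hnu.1, colOp_apply hnu.2, ite_zero_mul_ite_zero, mul_one]

theorem commute_colOp (a b : ℕ) : Commute (colOp a) (colOp b) := by
  refine IncidenceAlgebra.ext fun mu lam h => ?_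
  rw [colOp_mul_colOp_apply, colOp_mul_colOp_apply, card_filter_numCols_comm h]

open Classical in
/-- The multiplicative monoid generated by the transfer operators, in which products over the
support of an exponent vector make sense. -/
def colMonoid : Submonoid (IncidenceAlgebra ℕ YoungDiagram) :=
  Submonoid.closure (Set.range colOp)

open Classical in
instance instIsMulCommutativeColMonoid : IsMulCommutative colMonoid := by
  refine Submonoid.isMulCommutative_closure (M := IncidenceAlgebra ℕ YoungDiagram) ?_
  rintro _ ⟨a, rfl⟩ _ ⟨b, rfl⟩
  exact commute_colOp a b

open Classical in
/-- `colOp k` as an element of the commutative monoid `colMonoid`. -/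
def colElt (k : ℕ) : colMonoid := ⟨colOp k, Submonoid.subset_closure ⟨k, rfl⟩⟩

/-- The product of the transfer operators for the exponents of `d`. -/
def colProd (d : ℕ →₀ ℕ) : IncidenceAlgebra ℕ YoungDiagram :=
  (d.prod fun _ k => colElt k : colMonoid)

open Classical in
theorem colProd_zero : colProd 0 = 1 := by
  simp [colProd]

theorem colProd_mapDomain (σ : Equiv.Perm ℕ) (d : ℕ →₀ ℕ) :
    colProd (d.mapDomain σ) = colProd d := by
  rw [colProd, colProd, ← Equiv.coe_toEmbedding σ, ← Finsupp.embDomain_eq_mapDomain,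
    Finsupp.prod_embDomain]

theorem colProd_add_single {d : ℕ →₀ ℕ} {n : ℕ} (h : d n = 0) (k : ℕ) :
    colProd (d + Finsupp.single n k) = colProd d * colOp k := by
  have hdisj : Disjoint d.support (Finsupp.single n k).support :=
    Disjoint.mono_right Finsupp.support_single_subset (by simpa using h)
  rw [colProd, Finsupp.prod_add_index_of_disjoint hdisj,
    Finsupp.prod_single_index (Subtype.ext colOp_zero : colElt 0 = 1)]
  rfl

theorem commute_colProd_colOp (d : ℕ →₀ ℕ) (k : ℕ) : Commute (colProd d) (colOp k) :=
  congrArg Subtype.val (mul_comm (d.prod fun _ k => colElt k) (colElt k))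

end Transfer

/-! ### Reverse plane partitions -/

namespace ReversePlanePartition

variable {lam mu nu : YoungDiagram}

theorem entry_mono (T : ReversePlanePartition lam mu) {i i' j j' : ℕ} (hi : i' ≤ i) (hj : j' ≤ j)
    (h : (i, j) ∈ lam) (h' : (i', j') ∉ mu) : T.entry i' j' ≤ T.entry i j := by
  have hmem {a b : ℕ} (ha : i' ≤ a) (ha' : a ≤ i) (hb : j' ≤ b) (hb' : b ≤ j) :
      (a, b) ∈ skewCells lam mu :=
    mem_skewCells.2 ⟨lam.up_left_mem ha' hb' h, fun hab => h' (mu.up_left_mem ha hb hab)⟩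
  calc T.entry i' j' ≤ T.entry i' j := hj.eq_or_lt.elim (fun h => h ▸ le_rfl)
        fun hj => T.row_weak hj (hmem le_rfl hi le_rfl hj.le) (hmem le_rfl hi hj.le le_rfl)
    _ ≤ T.entry i j := hi.eq_or_lt.elim (fun h => h ▸ le_rfl)
        fun hi => T.col_weak hi (hmem le_rfl hi.le hj le_rfl) (hmem hi.le le_rfl hj le_rfl)

theorem weight_apply (T : ReversePlanePartition lam mu) (k : ℕ) :
    T.weight k =
      (((skewCells lam mu).filter fun c => T.entry c.1 c.2 = k).image Prod.snd).card := by
  have hfiber : T.weight k = (((skewCells lam mu).image fun c => (T.entry c.1 c.2, c.2)).filter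
      fun p => p.1 = k).card := by
    simp only [weight, Finsupp.coe_finsetSum, Finset.sum_apply, Finsupp.single_apply,
      Finset.card_filter]
  have hinj : Set.InjOn Prod.snd {p : ℕ × ℕ | p.1 = k} :=
    fun p hp q hq hpq => Prod.ext (hp.trans hq.symm) hpq
  rw [hfiber, Finset.filter_image,
    ← Finset.card_image_of_injOn (f := Prod.snd) (hinj.mono fun p => by
      simp only [Finset.coe_image, Finset.coe_filter]
      rintro ⟨c, hc, rfl⟩
      exact hc.2), Finset.image_image]
  rfl

theorem mem_support_weight (T : ReversePlanePartition lam mu) {k : ℕ} :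
    k ∈ T.weight.support ↔ ∃ c ∈ skewCells lam mu, T.entry c.1 c.2 = k := by
  rw [Finsupp.mem_support_iff, weight_apply, Finset.card_ne_zero, Finset.image_nonempty,
    Finset.filter_nonempty_iff]

theorem entry_mem_support_weight (T : ReversePlanePartition lam mu) {c : ℕ × ℕ}
    (hc : c ∈ skewCells lam mu) : T.entry c.1 c.2 ∈ T.weight.support :=
  T.mem_support_weight.2 ⟨c, hc, rfl⟩

theorem finite_weight_eq (lam mu : YoungDiagram) (d : ℕ →₀ ℕ) :
    Finite {T : ReversePlanePartition lam mu // T.weight = d} := by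
  refine Finite.of_injective (β := skewCells lam mu → d.support)
    (fun T c => ⟨T.1.entry c.1.1 c.1.2,
      congrArg Finsupp.support T.2 ▸ T.1.entry_mem_support_weight c.2⟩) fun T T' h => ?_
  ext i j
  by_cases hc : (i, j) ∈ skewCells lam mu
  · exact congrArg Subtype.val (congrFun h ⟨(i, j), hc⟩)
  · rw [T.1.zeros hc, T'.1.zeros hc]

theorem degree_weight (T : ReversePlanePartition lam mu) :
    T.weight.degree = ((skewCells lam mu).image fun c => (T.entry c.1 c.2, c.2)).card := by
  rw [weight, map_sum, Finset.card_eq_sum_ones]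
  exact Finset.sum_congr rfl fun p _ => Finsupp.degree_single _ _

theorem degree_weight_le (T : ReversePlanePartition lam mu) :
    T.weight.degree ≤ (skewCells lam mu).card :=
  T.degree_weight.trans_le Finset.card_image_le

/-- The diagram consisting of `mu` and the cells with entry less than `n`. -/
def below (T : ReversePlanePartition lam mu) (n : ℕ) : YoungDiagram where
  cells := mu.cells ∪ (skewCells lam mu).filter fun c => T.entry c.1 c.2 < n
  isLowerSet := by
    rintro ⟨i, j⟩ ⟨i', j'⟩ hle hc
    simp only [Finset.coe_union, Set.mem_union, Finset.mem_coe, YoungDiagram.mem_cells,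
      Finset.mem_filter, mem_skewCells] at hc ⊢
    by_cases h' : (i', j') ∈ mu
    · exact Or.inl h'
    · rcases hc with hc | ⟨hc, h⟩
      · exact absurd (mu.up_left_mem hle.1 hle.2 hc) h'
      · exact Or.inr ⟨⟨lam.up_left_mem hle.1 hle.2 hc.1, h'⟩,
          (T.entry_mono hle.1 hle.2 hc.1 h').trans_lt h⟩

theorem mem_below (T : ReversePlanePartition lam mu) {n : ℕ} {c : ℕ × ℕ} :
    c ∈ T.below n ↔ c ∈ mu ∨ c ∈ skewCells lam mu ∧ T.entry c.1 c.2 < n := by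
  rw [← YoungDiagram.mem_cells]
  simp [below]

theorem le_below (T : ReversePlanePartition lam mu) (n : ℕ) : mu ≤ T.below n :=
  fun _ hc => T.mem_below.2 (Or.inl hc)

theorem below_le (T : ReversePlanePartition lam mu) (n : ℕ) (h : mu ≤ lam) : T.below n ≤ lam :=
  fun _ hc => (T.mem_below.1 hc).elim (fun hmu => h hmu) fun hskew => (mem_skewCells.1 hskew.1).1

/-- Restriction of a reverse plane partition to a smaller outer shape. -/
def restrict (T : ReversePlanePartition lam mu) (h : nu ≤ lam) : ReversePlanePartition nu mu where
  entry i j := if (i, j) ∈ nu then T.entry i j else 0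
  row_weak {i j₁ j₂} hj hleft hright := by
    rw [mem_skewCells] at hleft hright
    rw [if_pos hleft.1, if_pos hright.1]
    exact T.entry_mono le_rfl hj.le (h hright.1) hleft.2
  col_weak {i₁ i₂ j} hi hupper hlower := by
    rw [mem_skewCells] at hupper hlower
    rw [if_pos hupper.1, if_pos hlower.1]
    exact T.entry_mono hi.le le_rfl (h hlower.1) hupper.2
  zeros {i j} hc := by
    rw [mem_skewCells, not_and, not_not] at hc
    split_ifs with hnu
    · exact T.zeros fun hskew => (mem_skewCells.1 hskew).2 (hc hnu)
    · rfl

theorem restrict_below_entry_lt (T : ReversePlanePartition lam mu) (n : ℕ) (h : mu ≤ lam) :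
    ∀ c ∈ skewCells (T.below n) mu, (T.restrict (T.below_le n h)).entry c.1 c.2 < n := by
  intro c hc
  rw [mem_skewCells] at hc
  exact (if_pos hc.1).trans_lt ((T.mem_below.1 hc.1).resolve_left hc.2).2

section Extend

variable (T : ReversePlanePartition nu mu) (hmu : mu ≤ nu) (hnu : nu ≤ lam) (n : ℕ)
  (hT : ∀ c ∈ skewCells nu mu, T.entry c.1 c.2 < n)

/-- Extension of a reverse plane partition with entries less than `n` to a larger outer shape by
filling the new cells with `n`. -/
def extend : ReversePlanePartition lam mu where
  entry i j := if (i, j) ∈ nu then T.entry i j else if (i, j) ∈ lam then n else 0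
  row_weak {i j₁ j₂} hj hleft hright := by
    rw [mem_skewCells] at hleft hright
    rw [if_pos hleft.1, if_pos hright.1]
    by_cases hmem : (i, j₂) ∈ nu
    · rw [if_pos hmem, if_pos (nu.up_left_mem le_rfl hj.le hmem)]
      exact T.entry_mono le_rfl hj.le hmem hleft.2
    · rw [if_neg hmem]
      split_ifs with hlam
      · exact (hT _ (mem_skewCells.2 ⟨hlam, hleft.2⟩)).le
      · rfl
  col_weak {i₁ i₂ j} hi hupper hlower := by
    rw [mem_skewCells] at hupper hlower
    rw [if_pos hupper.1, if_pos hlower.1]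
    by_cases hmem : (i₂, j) ∈ nu
    · rw [if_pos hmem, if_pos (nu.up_left_mem hi.le le_rfl hmem)]
      exact T.entry_mono hi.le le_rfl hmem hupper.2
    · rw [if_neg hmem]
      split_ifs with hlam
      · exact (hT _ (mem_skewCells.2 ⟨hlam, hupper.2⟩)).le
      · rfl
  zeros {i j} hc := by
    rw [mem_skewCells, not_and, not_not] at hc
    split_ifs with hnu' hlam
    · exact T.zeros fun hskew => (mem_skewCells.1 hskew).2 (hc (hnu hnu'))
    · exact absurd (hmu (hc hlam)) hnu'
    · rfl

theorem extend_entry_of_mem {c : ℕ × ℕ} (h : c ∈ nu) :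
    (T.extend hmu hnu n hT).entry c.1 c.2 = T.entry c.1 c.2 :=
  if_pos h

theorem extend_entry_of_notMem {c : ℕ × ℕ} (h : c ∈ lam) (h' : c ∉ nu) :
    (T.extend hmu hnu n hT).entry c.1 c.2 = n :=
  (if_neg h').trans (if_pos h)

theorem extend_injective {T' : ReversePlanePartition nu mu}
    (hT' : ∀ c ∈ skewCells nu mu, T'.entry c.1 c.2 < n)
    (h : T.extend hmu hnu n hT = T'.extend hmu hnu n hT') : T = T' := by
  ext i j
  by_cases hij : (i, j) ∈ nu
  · rw [← extend_entry_of_mem T hmu hnu n hT hij, h, extend_entry_of_mem T' hmu hnu n hT' hij]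
  · rw [T.zeros, T'.zeros] <;> simp [hij]

theorem below_extend : (T.extend hmu hnu n hT).below n = nu := by
  refine SetLike.ext fun c => ?_
  rw [mem_below]
  by_cases h : c ∈ nu
  · rw [extend_entry_of_mem _ _ _ _ _ h]
    refine iff_of_true (or_iff_not_imp_left.2 fun hc => ?_) h
    exact ⟨mem_skewCells.2 ⟨hnu h, hc⟩, hT c (mem_skewCells.2 ⟨h, hc⟩)⟩
  · refine iff_of_false ?_ h
    rintro (hc | ⟨hc, hlt⟩)
    · exact h (hmu hc)
    · exact hlt.ne (extend_entry_of_notMem _ _ _ _ _ (mem_skewCells.1 hc).1 h)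

theorem filter_extend_entry_eq_self :
    (skewCells lam mu).filter (fun c => (T.extend hmu hnu n hT).entry c.1 c.2 = n) =
      skewCells lam nu := by
  ext c
  simp only [Finset.mem_filter, mem_skewCells]
  refine ⟨fun ⟨⟨hlam, hc⟩, hn⟩ => ⟨hlam, fun h => ?_⟩, fun ⟨hlam, hc⟩ =>
    ⟨⟨hlam, fun h => hc (hmu h)⟩, extend_entry_of_notMem _ _ _ _ _ hlam hc⟩⟩
  rw [extend_entry_of_mem _ _ _ _ _ h] at hn
  exact (hT c (mem_skewCells.2 ⟨h, hc⟩)).ne hn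

theorem filter_extend_entry_eq_of_ne {k : ℕ} (hk : k ≠ n) :
    (skewCells lam mu).filter (fun c => (T.extend hmu hnu n hT).entry c.1 c.2 = k) =
      (skewCells nu mu).filter fun c => T.entry c.1 c.2 = k := by
  ext c
  simp only [Finset.mem_filter, mem_skewCells]
  by_cases h : c ∈ nu
  · simp [extend_entry_of_mem _ _ _ _ _ h, h, hnu h]
  · have hne (hlam : c ∈ lam) : (T.extend hmu hnu n hT).entry c.1 c.2 ≠ k :=
      (extend_entry_of_notMem _ _ _ _ _ hlam h).trans_ne hk.symm
    tauto

theorem weight_extend :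
    (T.extend hmu hnu n hT).weight = T.weight + Finsupp.single n (numCols lam nu) := by
  ext k
  rw [Finsupp.add_apply, weight_apply]
  rcases eq_or_ne k n with rfl | hk
  · have hzero : T.weight k = 0 := Finsupp.notMem_support_iff.1 fun h => by
      obtain ⟨c, hc, hck⟩ := T.mem_support_weight.1 h
      exact (hT c hc).ne hck
    rw [hzero, Finsupp.single_eq_same, zero_add, numCols, filter_extend_entry_eq_self]
  · rw [weight_apply, Finsupp.single_eq_of_ne hk, add_zero,
      filter_extend_entry_eq_of_ne _ _ _ _ _ hk]

end Extend

theorem extend_restrict_below (T : ReversePlanePartition lam mu) {n : ℕ} (h : mu ≤ lam)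
    (hT : ∀ c ∈ skewCells lam mu, T.entry c.1 c.2 ≤ n) :
    (T.restrict (T.below_le n h)).extend (T.le_below n) (T.below_le n h) n
      (T.restrict_below_entry_lt n h) = T := by
  ext i j
  simp only [extend, restrict]
  split_ifs with hbelow hlam
  · rfl
  · rw [mem_below, not_or, not_and] at hbelow
    have hskew : (i, j) ∈ skewCells lam mu := mem_skewCells.2 ⟨hlam, hbelow.1⟩
    exact le_antisymm (not_lt.1 (hbelow.2 hskew)) (hT _ hskew)
  · exact (T.zeros (by simp [hlam])).symm

section WeightExtend

variable {n : ℕ} {d : ℕ →₀ ℕ} (hd : ∀ m ∈ d.support, m < n)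

include hd

theorem entry_lt_of_weight_eq {T : ReversePlanePartition lam mu} (hT : T.weight = d) :
    ∀ c ∈ skewCells lam mu, T.entry c.1 c.2 < n :=
  fun _ hc => hd _ (hT ▸ T.entry_mem_support_weight hc)

theorem entry_le_of_weight_eq_add_single {T : ReversePlanePartition lam mu} {k : ℕ}
    (hT : T.weight = d + Finsupp.single n k) : ∀ c ∈ skewCells lam mu, T.entry c.1 c.2 ≤ n := by
  intro c hc
  have hmem := T.entry_mem_support_weight hc
  rw [hT] at hmem
  rcases Finset.mem_union.1 (Finsupp.support_add hmem) with h | h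
  · exact (hd _ h).le
  · exact (Finset.mem_singleton.1 (Finsupp.support_single_subset h)).le

theorem weight_restrict_below_of_weight_eq {T : ReversePlanePartition lam mu} {k : ℕ}
    (h : mu ≤ lam) (hT : T.weight = d + Finsupp.single n k) :
    numCols lam (T.below n) = k ∧ (T.restrict (T.below_le n h)).weight = d := by
  have hext := weight_extend _ (T.le_below n) (T.below_le n h) n (T.restrict_below_entry_lt n h)
  rw [T.extend_restrict_below h (entry_le_of_weight_eq_add_single hd hT), hT] at hext
  have hdn : d n = 0 := Finsupp.notMem_support_iff.1 fun hn => lt_irrefl n (hd n hn)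
  have hres : (T.restrict (T.below_le n h)).weight n = 0 :=
    Finsupp.notMem_support_iff.1 fun hn => by
      obtain ⟨c, hc, hcn⟩ := mem_support_weight _ |>.1 hn
      exact (T.restrict_below_entry_lt n h c hc).ne hcn
  have hk : numCols lam (T.below n) = k := by
    simpa [hdn, hres] using (DFunLike.congr_fun hext n).symm
  exact ⟨hk, (add_right_cancel (hk ▸ hext)).symm⟩

/-- A reverse plane partition with largest possible entry `n` is determined by the shape of its
entries less than `n` and their filling. -/
def weightEquiv (h : mu ≤ lam) (k : ℕ) :
    (Σ nu : {nu // nu ∈ (Finset.Icc mu lam).filter fun nu => numCols lam nu = k},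
      {T : ReversePlanePartition nu mu // T.weight = d}) ≃
    {T : ReversePlanePartition lam mu // T.weight = d + Finsupp.single n k} :=
  Equiv.ofBijective (fun p =>
    have hp := Finset.mem_filter.1 p.1.2
    have hI := Finset.mem_Icc.1 hp.1
    ⟨p.2.1.extend hI.1 hI.2 n (entry_lt_of_weight_eq hd p.2.2), by
      rw [weight_extend, p.2.2, hp.2]⟩) <| by
    constructor
    · rintro ⟨⟨nu, hnu⟩, T, hT⟩ ⟨⟨nu', hnu'⟩, T', hT'⟩ heq
      have hext := congrArg Subtype.val heq
      obtain rfl : nu = nu' := by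
        simpa only [below_extend] using congrArg (fun S => below S n) hext
      have hI := Finset.mem_Icc.1 (Finset.mem_filter.1 hnu).1
      obtain rfl : T = T' := extend_injective T hI.1 hI.2 n (entry_lt_of_weight_eq hd hT)
        (entry_lt_of_weight_eq hd hT') hext
      rfl
    · rintro ⟨T, hT⟩
      obtain ⟨hk, hw⟩ := weight_restrict_below_of_weight_eq hd h hT
      exact ⟨⟨⟨T.below n, Finset.mem_filter.2
        ⟨Finset.mem_Icc.2 ⟨T.le_below n, T.below_le n h⟩, hk⟩⟩, T.restrict _, hw⟩,
        Subtype.ext (T.extend_restrict_below h (entry_le_of_weight_eq_add_single hd hT))⟩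

end WeightExtend

open Classical in
theorem card_weight_eq_zero (h : mu ≤ lam) :
    Nat.card {T : ReversePlanePartition lam mu // T.weight = 0} = if mu = lam then 1 else 0 := by
  have hempty (T : {T : ReversePlanePartition lam mu // T.weight = 0}) : skewCells lam mu = ∅ :=
    Finset.eq_empty_of_forall_notMem fun c hc => by
      simpa [T.2] using T.1.entry_mem_support_weight hc
  split_ifs with he
  · subst he
    refine Nat.card_eq_one_iff_unique.2 ⟨⟨fun T T' => ?_⟩,
      ⟨⟨⟨fun _ _ => 0, fun _ _ _ => le_rfl, fun _ _ _ => le_rfl, fun _ => rfl⟩, ?_⟩⟩⟩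
    · ext i j
      rw [T.1.zeros (by simp), T'.1.zeros (by simp)]
    · simp [weight, skewCells]
  · refine Nat.card_eq_zero.2 (Or.inl ⟨fun T => he (h.antisymm ?_)⟩)
    exact YoungDiagram.cells_subset_iff.1 (Finset.sdiff_eq_empty_iff_subset.1 (hempty T))

open Classical in
theorem card_weight_eq (h : mu ≤ lam) (d : ℕ →₀ ℕ) :
    Nat.card {T : ReversePlanePartition lam mu // T.weight = d} = colProd d mu lam := by
  induction d using Finsupp.induction_on_max₂ generalizing lam with
  | zero => rw [card_weight_eq_zero h, colProd_zero, IncidenceAlgebra.one_apply]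
  | add_single n k d hd _ ih =>
    have hdn : d n = 0 := Finsupp.notMem_support_iff.1 fun hn => lt_irrefl n (hd n hn)
    have (nu : YoungDiagram) := finite_weight_eq nu mu d
    rw [← Nat.card_congr (weightEquiv hd h k), Nat.card_sigma, colProd_add_single hdn,
      IncidenceAlgebra.mul_apply, Finset.sum_coe_sort _ fun nu =>
        Nat.card {T : ReversePlanePartition nu mu // T.weight = d}, Finset.sum_filter]
    refine Finset.sum_congr rfl fun nu hnu => ?_
    rw [Finset.mem_Icc] at hnu
    rw [colOp_apply hnu.2, ih hnu.1, mul_ite, mul_one, mul_zero]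

end ReversePlanePartition

section DualGrothendieck

variable (K : Type*) [CommRing K]

theorem coeff_dualGrothendieck {lam mu : YoungDiagram} (h : mu ≤ lam) (d : ℕ →₀ ℕ) :
    coeff d (dualGrothendieck K lam mu) = (colProd d mu lam : K) :=
  congrArg Nat.cast (ReversePlanePartition.card_weight_eq h d)

theorem coeff_dualGrothendieck_of_card_lt {lam mu : YoungDiagram} {d : ℕ →₀ ℕ}
    (h : (skewCells lam mu).card < d.degree) : coeff d (dualGrothendieck K lam mu) = 0 := by
  have : IsEmpty {T : ReversePlanePartition lam mu // T.weight = d} :=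
    ⟨fun T => absurd T.1.degree_weight_le (by rw [T.2]; exact not_le.2 h)⟩
  change (Nat.card {T : ReversePlanePartition lam mu // T.weight = d} : K) = 0
  rw [Nat.card_of_isEmpty, Nat.cast_zero]

theorem dualGrothendieck_mem (lam mu : YoungDiagram) (h : mu ≤ lam) :
    dualGrothendieck K lam mu ∈ SymmFn K := by
  refine ⟨(mem_completed_iff _).2 fun σ d => ?_, (skewCells lam mu).card, fun d hd =>
    coeff_dualGrothendieck_of_card_lt K hd⟩
  rw [coeff_dualGrothendieck K h, coeff_dualGrothendieck K h, colProd_mapDomain]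

end DualGrothendieck

/-! ### Schur functions -/

@[simp]
theorem skewCells_bot (lam : YoungDiagram) : skewCells lam ⊥ = lam.cells := by
  simp [skewCells]

theorem degree_content {lam : YoungDiagram} (T : SemistandardYoungTableau lam) :
    (content T).degree = lam.card := by
  rw [content, map_sum, YoungDiagram.card, Finset.card_eq_sum_ones]
  exact Finset.sum_congr rfl fun c _ => Finsupp.degree_single _ _

namespace ReversePlanePartition

variable {lam mu : YoungDiagram}

theorem entry_strictMono_of_degree_weight_eq (T : ReversePlanePartition lam mu)
    (hT : T.weight.degree = (skewCells lam mu).card) {i i' j : ℕ} (hi : i' < i) (h : (i, j) ∈ lam)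
    (h' : (i', j) ∉ mu) : T.entry i' j < T.entry i j := by
  refine (T.entry_mono hi.le le_rfl h h').lt_of_ne fun heq => hi.ne ?_
  have hinj := Finset.injOn_of_card_image_eq (T.degree_weight.symm.trans hT)
  refine congrArg Prod.fst (@hinj (i', j) (mem_skewCells.2 ⟨lam.up_left_mem hi.le le_rfl h, h'⟩)
    (i, j) (mem_skewCells.2 ⟨h, fun hmu => h' (mu.up_left_mem hi.le le_rfl hmu)⟩) ?_)
  exact Prod.ext heq rfl

/-- A semistandard tableau as a reverse plane partition. -/
def ofTableau (T : SemistandardYoungTableau lam) : ReversePlanePartition lam ⊥ where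
  entry := T
  row_weak hj _ h := T.row_weak hj (mem_skewCells.1 h).1
  col_weak hi _ h := T.col_weak hi.le (mem_skewCells.1 h).1
  zeros h := T.zeros (by simpa using h)

theorem weight_ofTableau (T : SemistandardYoungTableau lam) : (ofTableau T).weight = content T := by
  rw [weight, skewCells_bot, Finset.sum_image]
  · rfl
  · rintro ⟨i, j⟩ hi ⟨i', j'⟩ hi' heq
    obtain ⟨hT, rfl⟩ : T i j = T i' j' ∧ j = j' := Prod.mk.inj heq
    rcases lt_trichotomy i i' with hlt | rfl | hlt
    · exact absurd hT (T.col_strict hlt hi').ne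
    · rfl
    · exact absurd hT (T.col_strict hlt hi).ne'

/-- The semistandard tableau underlying a reverse plane partition of largest possible degree. -/
def toTableau (T : ReversePlanePartition lam ⊥) (hT : T.weight.degree = lam.card) :
    SemistandardYoungTableau lam where
  entry := T.entry
  row_weak' hj h := T.entry_mono le_rfl hj.le h (YoungDiagram.notMem_bot _)
  col_strict' hi h := T.entry_strictMono_of_degree_weight_eq
    (hT.trans (congrArg Finset.card (skewCells_bot lam)).symm) hi h (YoungDiagram.notMem_bot _)
  zeros' h := T.zeros (by simpa using h)

/-- Semistandard tableaux are the reverse plane partitions of largest possible degree. -/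
def tableauEquiv {d : ℕ →₀ ℕ} (hd : d.degree = lam.card) :
    {T : SemistandardYoungTableau lam // content T = d} ≃
      {T : ReversePlanePartition lam ⊥ // T.weight = d} where
  toFun T := ⟨ofTableau T.1, (weight_ofTableau T.1).trans T.2⟩
  invFun T :=
    ⟨T.1.toTableau (T.2.symm ▸ hd), (weight_ofTableau (T.1.toTableau _)).symm.trans T.2⟩
  left_inv _ := rfl
  right_inv _ := rfl

end ReversePlanePartition

section Schur

variable (K : Type*) [CommRing K]

variable {K} in
theorem exists_content_eq_of_coeff_schur_ne_zero {lam : YoungDiagram} {d : ℕ →₀ ℕ}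
    (h : coeff d (schur K lam) ≠ 0) : ∃ T : SemistandardYoungTableau lam, content T = d := by
  by_contra! hne
  have : IsEmpty {T : SemistandardYoungTableau lam // content T = d} := ⟨fun T => hne T.1 T.2⟩
  exact h (congrArg Nat.cast Nat.card_of_isEmpty |>.trans Nat.cast_zero)

theorem coeff_schur_of_degree_eq {lam : YoungDiagram} {d : ℕ →₀ ℕ} (hd : d.degree = lam.card) :
    coeff d (schur K lam) = coeff d (dualGrothendieck K lam ⊥) :=
  congrArg Nat.cast (Nat.card_congr (ReversePlanePartition.tableauEquiv hd))

theorem coeff_schur_of_degree_ne {lam : YoungDiagram} {d : ℕ →₀ ℕ} (hd : d.degree ≠ lam.card) :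
    coeff d (schur K lam) = 0 := by
  by_contra h
  obtain ⟨T, rfl⟩ := exists_content_eq_of_coeff_schur_ne_zero h
  exact hd (degree_content T)

theorem schur_mem (lam : YoungDiagram) : schur K lam ∈ SymmFn K := by
  refine ⟨(mem_completed_iff _).2 fun σ d => ?_, lam.card, fun d hd =>
    coeff_schur_of_degree_ne K hd.ne'⟩
  have hdeg : (d.mapDomain σ).degree = d.degree := Finsupp.degree_mapDomain _ _
  by_cases hd : d.degree = lam.card
  · rw [coeff_schur_of_degree_eq K hd, coeff_schur_of_degree_eq K (hdeg.trans hd)]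
    exact (mem_completed_iff _).1 (dualGrothendieck_mem K lam ⊥ bot_le).1 σ d
  · rw [coeff_schur_of_degree_ne K hd, coeff_schur_of_degree_ne K (by rwa [hdeg])]

end Schur

/-! ### Unitriangularity of the Schur functions -/

/-- The exponent vector whose entries are the row lengths of a Young diagram. -/
def rowVec (mu : YoungDiagram) : ℕ →₀ ℕ := ∑ c ∈ mu.cells, Finsupp.single c.1 1

theorem degree_rowVec (mu : YoungDiagram) : (rowVec mu).degree = mu.card := by
  rw [rowVec, map_sum, YoungDiagram.card, Finset.card_eq_sum_ones]
  exact Finset.sum_congr rfl fun c _ => Finsupp.degree_single _ _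

theorem rowVec_apply (mu : YoungDiagram) (i : ℕ) : rowVec mu i = mu.rowLen i := by
  rw [rowVec, YoungDiagram.rowLen_eq_card, YoungDiagram.row, Finset.card_filter,
    Finsupp.finsetSum_apply]
  simp only [Finsupp.single_apply]

theorem rowVec_injective : Function.Injective rowVec := by
  refine fun mu nu h => SetLike.ext fun ⟨i, j⟩ => ?_
  rw [YoungDiagram.mem_iff_lt_rowLen, YoungDiagram.mem_iff_lt_rowLen, ← rowVec_apply, h,
    rowVec_apply]

/-- The sum of the row indices of the cells of a Young diagram. Schur functions are unitriangular
with respect to it. -/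
def rowStat (mu : YoungDiagram) : ℕ := ∑ c ∈ mu.cells, c.1

theorem row_le_entry {lam : YoungDiagram} (T : SemistandardYoungTableau lam) {i j : ℕ}
    (h : (i, j) ∈ lam) : i ≤ T i j := by
  induction i with
  | zero => exact Nat.zero_le _
  | succ i ih =>
    exact (ih (lam.up_left_mem i.le_succ le_rfl h)).trans_lt (T.col_strict i.lt_succ_self h)

section Content

variable {lam mu : YoungDiagram} {T : SemistandardYoungTableau lam}

theorem sum_entry_eq_rowStat (h : content T = rowVec mu) :
    ∑ c ∈ lam.cells, T c.1 c.2 = rowStat mu := by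
  simpa [content, rowVec, rowStat, Finsupp.weight_single] using
    congrArg (Finsupp.weight fun i : ℕ => i) h

theorem row_eq_entry_of_rowStat_le (h : content T = rowVec mu) (hle : rowStat mu ≤ rowStat lam) :
    ∀ c ∈ lam.cells, c.1 = T c.1 c.2 := by
  have hrow : ∀ c ∈ lam.cells, c.1 ≤ T c.1 c.2 := fun c hc => row_le_entry T hc
  exact (Finset.sum_eq_sum_iff_of_le hrow).1
    ((Finset.sum_le_sum hrow).antisymm ((sum_entry_eq_rowStat h).trans_le hle))

theorem eq_of_rowStat_le (h : content T = rowVec mu) (hle : rowStat mu ≤ rowStat lam) :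
    lam = mu := by
  refine rowVec_injective (h ▸ Finset.sum_congr rfl fun c hc => ?_)
  rw [← row_eq_entry_of_rowStat_le h hle c hc]

end Content

section Unitriangular

variable (K : Type*) [CommRing K]

theorem content_highestWeight (mu : YoungDiagram) :
    content (SemistandardYoungTableau.highestWeight mu) = rowVec mu :=
  Finset.sum_congr rfl fun c hc => by
    rw [SemistandardYoungTableau.highestWeight_apply, if_pos ((YoungDiagram.mem_cells _).1 hc)]

theorem coeff_rowVec_schur_self (mu : YoungDiagram) : coeff (rowVec mu) (schur K mu) = 1 := by
  have hunique (T : SemistandardYoungTableau mu) (hT : content T = rowVec mu) :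
      T = SemistandardYoungTableau.highestWeight mu := by
    ext i j
    rw [SemistandardYoungTableau.highestWeight_apply]
    split_ifs with h
    · exact (row_eq_entry_of_rowStat_le hT le_rfl (i, j) h).symm
    · exact T.zeros h
  have : Unique {T : SemistandardYoungTableau mu // content T = rowVec mu} :=
    ⟨⟨⟨_, content_highestWeight mu⟩⟩, fun T => Subtype.ext (hunique T.1 T.2)⟩
  exact congrArg Nat.cast Nat.card_unique |>.trans Nat.cast_one

theorem coeff_rowVec_schur_eq_zero {lam mu : YoungDiagram} (hne : lam ≠ mu)
    (h : rowStat mu ≤ rowStat lam) : coeff (rowVec mu) (schur K lam) = 0 := by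
  by_contra hcoeff
  obtain ⟨T, hT⟩ := exists_content_eq_of_coeff_schur_ne_zero hcoeff
  exact hne (eq_of_rowStat_le hT h)

end Unitriangular

/-! ### Rearranging exponent vectors into partitions -/

/-- The Young diagram whose row lengths are the entries of an antitone exponent vector. -/
def ofAntitone (d : ℕ →₀ ℕ) (h : Antitone d) : YoungDiagram where
  cells := d.support.biUnion fun i => (Finset.range (d i)).map (Function.Embedding.sectR i ℕ)
  isLowerSet := by
    rintro ⟨a, b⟩ ⟨i, j⟩ ⟨hi : i ≤ a, hj : j ≤ b⟩ hab
    simp only [Finset.mem_coe, Finset.mem_biUnion, Finsupp.mem_support_iff, Finset.mem_map,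
      Finset.mem_range, Function.Embedding.sectR_apply, Prod.mk.injEq] at hab ⊢
    obtain ⟨a, -, b, hb, rfl, rfl⟩ := hab
    have := h hi
    exact ⟨i, by omega, j, by omega, rfl, rfl⟩

theorem rowVec_ofAntitone (d : ℕ →₀ ℕ) (h : Antitone d) : rowVec (ofAntitone d h) = d := by
  ext i
  rw [rowVec_apply]
  refine eq_of_forall_lt_iff fun j => ?_
  rw [← YoungDiagram.mem_iff_lt_rowLen, ← YoungDiagram.mem_cells]
  simpa [ofAntitone] using fun hj : j < d i => Nat.ne_zero_of_lt hj

theorem exists_perm_antitone_mapDomain {M : Type*} [AddCommMonoid M] [LinearOrder M]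
    [CanonicallyOrderedAdd M] (d : ℕ →₀ M) : ∃ σ : Equiv.Perm ℕ, Antitone (d.mapDomain σ) := by
  obtain ⟨n, hsupp⟩ := d.support.exists_nat_subset_range
  have hn (i : ℕ) (hi : n ≤ i) : d i = 0 := Finsupp.notMem_support_iff.1 fun h =>
    hi.not_gt (Finset.mem_range.1 (hsupp h))
  let f : Fin n → Mᵒᵈ := fun i => OrderDual.toDual (d i)
  let τ : Equiv.Perm ℕ := (Tuple.sort f).extendDomain Fin.equivSubtype
  have hτ_lt (i : ℕ) (hi : i < n) : τ i = Tuple.sort f ⟨i, hi⟩ :=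
    Equiv.Perm.extendDomain_apply_subtype (Tuple.sort f) Fin.equivSubtype hi
  have hτ_ge (i : ℕ) (hi : n ≤ i) : τ i = i :=
    Equiv.Perm.extendDomain_apply_not_subtype (Tuple.sort f) Fin.equivSubtype (not_lt.2 hi)
  have hd (i : ℕ) : d.mapDomain τ.symm i = d (τ i) := by
    rw [← Finsupp.mapDomain_apply τ.symm.injective d, τ.symm_apply_apply]
  refine ⟨τ.symm, fun i j hij => ?_⟩
  rw [hd, hd]
  rcases lt_or_ge j n with hj | hj
  · rw [hτ_lt i (hij.trans_lt hj), hτ_lt j hj]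
    exact Tuple.monotone_sort f (show (⟨i, hij.trans_lt hj⟩ : Fin n) ≤ ⟨j, hj⟩ from hij)
  · rw [hτ_ge j hj, hn j hj]
    exact zero_le

theorem completed_ext {K : Type*} [CommRing K] {F G : Completed K}
    (h : ∀ mu, coeff (rowVec mu) (F : MvPowerSeries ℕ K) = coeff (rowVec mu) G) : F = G := by
  refine Subtype.ext (MvPowerSeries.ext fun d => ?_)
  obtain ⟨σ, hσ⟩ := exists_perm_antitone_mapDomain d
  rw [← (mem_completed_iff _).1 F.2 σ d, ← (mem_completed_iff _).1 G.2 σ d,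
    ← rowVec_ofAntitone _ hσ, h]

/-! ### Expansion into Schur functions -/

theorem finite_card_eq (n : ℕ) : {lam : YoungDiagram | lam.card = n}.Finite := by
  refine Set.Finite.of_finite_image (f := YoungDiagram.cells)
    ((Finset.range n ×ˢ Finset.range n).powerset.finite_toSet.subset ?_)
    fun x _ y _ h => YoungDiagram.ext h
  rintro _ ⟨lam, rfl, rfl⟩
  refine Finset.mem_coe.2 (Finset.mem_powerset.2 fun ⟨i, j⟩ hij => ?_)
  rw [YoungDiagram.mem_cells] at hij
  have hcol : lam.colLen j ≤ lam.card := by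
    rw [YoungDiagram.colLen_eq_card]
    exact Finset.card_filter_le _ _
  have hrow : lam.rowLen i ≤ lam.card := by
    rw [YoungDiagram.rowLen_eq_card]
    exact Finset.card_filter_le _ _
  exact Finset.mem_product.2
    ⟨Finset.mem_range.2 ((YoungDiagram.mem_iff_lt_colLen.1 hij).trans_le hcol),
      Finset.mem_range.2 ((YoungDiagram.mem_iff_lt_rowLen.1 hij).trans_le hrow)⟩

/-- The Young diagrams with `n` cells. -/
def diagrams (n : ℕ) : Finset YoungDiagram := (finite_card_eq n).toFinset

@[simp]
theorem mem_diagrams {n : ℕ} {lam : YoungDiagram} : lam ∈ diagrams n ↔ lam.card = n := by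
  simp [diagrams]

theorem bijective_add_sum_mul {ι R : Type*} [Ring R] (rank : ι → ℕ) (s : ι → Finset ι)
    (hs : ∀ i, ∀ j ∈ s i, rank j < rank i) (M : ι → ι → R) :
    Function.Bijective fun (A : ι → R) i => A i + ∑ j ∈ s i, A j * M i j := by
  constructor
  · refine fun A B h => funext fun i => ?_
    induction hi : rank i using Nat.strong_induction_on generalizing i with
    | _ n ih =>
      have hsum : ∑ j ∈ s i, A j * M i j = ∑ j ∈ s i, B j * M i j :=
        Finset.sum_congr rfl fun j hj => by rw [ih _ (hi ▸ hs i j hj) j rfl]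
      exact add_right_cancel ((congrFun h i).trans (congrArg (B i + ·) hsum.symm))
  · intro B
    let A : ι → R := (measure rank).wf.fix fun i A =>
      B i - ∑ j ∈ (s i).attach, A j.1 (hs i j.1 j.2) * M i j.1
    have hA (i : ι) : A i = B i - ∑ j ∈ s i, A j * M i j :=
      ((measure rank).wf.fix_eq _ i).trans
        (congrArg (B i - ·) (Finset.sum_attach (s i) fun j => A j * M i j))
    exact ⟨A, funext fun i => (congrArg (· + _) (hA i)).trans (sub_add_cancel _ _)⟩

section SchurExpansion

variable {K : Type*} [CommRing K]

theorem finsum_mul_coeff_schur (A : YoungDiagram → K) (d : ℕ →₀ ℕ) :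
    ∑ᶠ lam, A lam * coeff d (schur K lam) =
      ∑ lam ∈ diagrams d.degree, A lam * coeff d (schur K lam) := by
  refine finsum_eq_sum_of_support_subset _ fun lam h => ?_
  rw [Finset.mem_coe, mem_diagrams]
  by_contra hne
  exact h (by beta_reduce; rw [coeff_schur_of_degree_ne K (Ne.symm hne), mul_zero])

/-- The (possibly infinite) linear combination of Schur functions with given coefficients. -/
def schurSum : (YoungDiagram → K) →ₗ[K] Completed K where
  toFun A := ⟨fun d => ∑ lam ∈ diagrams d.degree, A lam * coeff d (schur K lam),
    (mem_completed_iff _).2 fun σ d => by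
      change ∑ lam ∈ diagrams (d.mapDomain σ).degree, A lam * coeff (d.mapDomain σ) (schur K lam) =
        ∑ lam ∈ diagrams d.degree, A lam * coeff d (schur K lam)
      rw [Finsupp.degree_mapDomain]
      simp only [(mem_completed_iff _).1 (schur_mem K _).1 σ d]⟩
  map_add' A B := Subtype.ext <| funext fun d => by
    simp only [Pi.add_apply, add_mul, Finset.sum_add_distrib]
    rfl
  map_smul' r A := Subtype.ext <| funext fun d => by
    simp only [Pi.smul_apply, smul_eq_mul, mul_assoc, ← Finset.mul_sum]
    rfl

theorem coeff_schurSum (A : YoungDiagram → K) (d : ℕ →₀ ℕ) :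
    coeff d (schurSum A : MvPowerSeries ℕ K) =
      ∑ lam ∈ diagrams d.degree, A lam * coeff d (schur K lam) :=
  rfl

theorem isSchurExpansion_iff {F : Completed K} {A : YoungDiagram → K} :
    IsSchurExpansion (F : MvPowerSeries ℕ K) A ↔ schurSum A = F := by
  simp only [IsSchurExpansion, finsum_mul_coeff_schur, ← coeff_schurSum, ← MvPowerSeries.ext_iff,
    Subtype.ext_iff, eq_comm]

theorem coeff_rowVec_schurSum (A : YoungDiagram → K) (mu : YoungDiagram) :
    coeff (rowVec mu) (schurSum A : MvPowerSeries ℕ K) = A mu +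
      ∑ lam ∈ diagrams mu.card with rowStat lam < rowStat mu,
        A lam * coeff (rowVec mu) (schur K lam) := by
  classical
  have hmu : mu ∈ diagrams mu.card := mem_diagrams.2 rfl
  rw [coeff_schurSum, degree_rowVec, ← Finset.add_sum_erase _ _ hmu, coeff_rowVec_schur_self,
    mul_one]
  congr 1
  refine (Finset.sum_subset (fun lam hlam => ?_) fun lam hlam hnot => ?_).symm
  · rw [Finset.mem_filter] at hlam
    exact Finset.mem_erase.2 ⟨fun h => hlam.2.ne (congrArg rowStat h), hlam.1⟩
  · rw [Finset.mem_erase] at hlam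
    rw [Finset.mem_filter, not_and, not_lt] at hnot
    rw [coeff_rowVec_schur_eq_zero K hlam.1 (hnot hlam.2), mul_zero]

theorem bijective_schurSum : Function.Bijective (schurSum (K := K)) := by
  have hcoeff : Function.Bijective fun (A : YoungDiagram → K) mu =>
      coeff (rowVec mu) (schurSum A : MvPowerSeries ℕ K) := by
    simp only [coeff_rowVec_schurSum]
    exact bijective_add_sum_mul rowStat _ (fun mu lam hlam => (Finset.mem_filter.1 hlam).2)
      fun mu lam => coeff (rowVec mu) (schur K lam)
  refine ⟨fun A B h => hcoeff.1 (by simp only [h]), fun F => ?_⟩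
  obtain ⟨A, hA⟩ := hcoeff.2 fun mu => coeff (rowVec mu) (F : MvPowerSeries ℕ K)
  exact ⟨A, completed_ext (congrFun hA)⟩

/-- Symmetric power series correspond to arbitrary families of Schur coefficients. -/
def schurEquiv : (YoungDiagram → K) ≃ₗ[K] Completed K :=
  LinearEquiv.ofBijective schurSum bijective_schurSum

theorem schurCoeff_eq_schurEquiv_symm (F : Completed K) : schurCoeff F = schurEquiv.symm F := by
  have h : ∃ A, IsSchurExpansion (F : MvPowerSeries ℕ K) A :=
    (bijective_schurSum.2 F).imp fun _ => isSchurExpansion_iff.2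
  rw [schurCoeff, dif_pos h, LinearEquiv.eq_symm_apply]
  exact isSchurExpansion_iff.1 h.choose_spec

theorem schurCoeff_eq_iff {F : Completed K} {A : YoungDiagram → K} :
    schurCoeff F = A ↔ schurSum A = F := by
  rw [schurCoeff_eq_schurEquiv_symm, LinearEquiv.symm_apply_eq, eq_comm]
  rfl

theorem coeff_eq_sum_schurCoeff (F : Completed K) (d : ℕ →₀ ℕ) :
    coeff d (F : MvPowerSeries ℕ K) =
      ∑ lam ∈ diagrams d.degree, schurCoeff F lam * coeff d (schur K lam) := by
  rw [← coeff_schurSum, schurCoeff_eq_iff.1 rfl]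

end SchurExpansion

/-! ### The degree filtration -/

section Filtration

variable {R M : Type*} [Ring R] [AddCommGroup M] [Module R M] {F : ℕ → Submodule R M}

theorem eq_top_of_forall_exists_sub_mem (hzero : F 0 = ⊥) (hF : ∀ x, ∃ m, x ∈ F m)
    {S : Submodule R M} (hS : ∀ m, ∀ x ∈ F (m + 1), ∃ y ∈ S, x - y ∈ F m) : S = ⊤ := by
  have key (m : ℕ) : F m ≤ S := by
    induction m with
    | zero => exact hzero.trans_le bot_le
    | succ m ih =>
      intro x hx
      obtain ⟨y, hy, hxy⟩ := hS m x hx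
      exact sub_add_cancel x y ▸ S.add_mem (ih hxy) hy
  exact Submodule.eq_top_iff'.2 fun x => (hF x).elim fun m hm => key m hm

theorem bijective_of_forall_sub_mem (hzero : F 0 = ⊥) (hF : ∀ x, ∃ m, x ∈ F m) {φ : M →ₗ[R] M}
    (hφ : ∀ m, ∀ x ∈ F (m + 1), φ x - x ∈ F m) : Function.Bijective φ := by
  constructor
  · refine (injective_iff_map_eq_zero φ).2 fun x hx => ?_
    have key (m : ℕ) : x ∈ F m → x = 0 := by
      induction m with
      | zero => exact fun h => (Submodule.mem_bot R).1 (hzero ▸ h)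
      | succ m ih => exact fun h => ih (by simpa [hx] using hφ m x h)
    exact (hF x).elim key
  · refine LinearMap.range_eq_top.1 (eq_top_of_forall_exists_sub_mem hzero hF fun m x hx =>
      ⟨φ x, LinearMap.mem_range_self φ x, ?_⟩)
    exact neg_sub (φ x) x ▸ (F m).neg_mem (hφ m x hx)

end Filtration

section DegreeLT

variable (K : Type*) [CommRing K]

/-- The submodule of symmetric functions without terms of degree `m` or more. -/
def degreeLT (m : ℕ) : Submodule K (SymmFn K) where
  carrier := {f | ∀ d : ℕ →₀ ℕ, m ≤ d.degree → coeff d (f : MvPowerSeries ℕ K) = 0}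
  zero_mem' d _ := coeff_zero d
  add_mem' {f g} hf hg d hd := (map_add (coeff d) (f : MvPowerSeries ℕ K) g).trans <| by
    rw [hf d hd, hg d hd, add_zero]
  smul_mem' r f hf d hd := (map_smul (coeff d) r (f : MvPowerSeries ℕ K)).trans <| by
    rw [hf d hd, smul_zero]

variable {K}

theorem sub_mem_degreeLT {m : ℕ} {f g : SymmFn K} : f - g ∈ degreeLT K m ↔
    ∀ d : ℕ →₀ ℕ, m ≤ d.degree →
      coeff d (f : MvPowerSeries ℕ K) = coeff d (g : MvPowerSeries ℕ K) :=
  forall₂_congr fun d _ => by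
    rw [AddSubgroupClass.coe_sub, map_sub, sub_eq_zero]

theorem degreeLT_zero : degreeLT K 0 = ⊥ :=
  (Submodule.eq_bot_iff _).2 fun _ hf =>
    Subtype.ext (MvPowerSeries.ext fun d => hf d (Nat.zero_le _))

theorem exists_mem_degreeLT (f : SymmFn K) : ∃ m, f ∈ degreeLT K m :=
  f.2.2.imp' (· + 1) fun _ hN d hd => hN d hd

end DegreeLT

/-! ### Spanning families -/

section Span

variable (K : Type*) [CommRing K]

theorem symmFn_le_completed : SymmFn K ≤ Completed K := fun _ hf => hf.1

/-- The Schur function `s_lam` as an element of the ring of symmetric functions. -/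
def schurFn (lam : YoungDiagram) : SymmFn K := ⟨schur K lam, schur_mem K lam⟩

open Classical in
/-- The dual stable Grothendieck polynomial `g_{lam/mu}` as an element of the ring of symmetric
functions, with the value `0` unless `mu ≤ lam`. -/
def skewG (lam mu : YoungDiagram) : SymmFn K :=
  if h : mu ≤ lam then ⟨dualGrothendieck K lam mu, dualGrothendieck_mem K lam mu h⟩ else 0

variable {K}

theorem skewG_of_le {lam mu : YoungDiagram} (h : mu ≤ lam) :
    skewG K lam mu = ⟨dualGrothendieck K lam mu, dualGrothendieck_mem K lam mu h⟩ :=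
  dif_pos h

theorem coe_skewG {lam mu : YoungDiagram} (h : mu ≤ lam) :
    (skewG K lam mu : MvPowerSeries ℕ K) = dualGrothendieck K lam mu := by
  rw [skewG_of_le h]

theorem span_range_eq_top {b : YoungDiagram → SymmFn K}
    (hb : ∀ lam, b lam - schurFn K lam ∈ degreeLT K lam.card) :
    Submodule.span K (Set.range b) = ⊤ := by
  refine eq_top_of_forall_exists_sub_mem (F := degreeLT K) degreeLT_zero
    exists_mem_degreeLT fun m f hf =>
    ⟨∑ lam ∈ diagrams m, schurCoeff (Subalgebra.inclusion (symmFn_le_completed K) f) lam • b lam,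
      Submodule.sum_mem _ fun lam _ => Submodule.smul_mem _ _ (Submodule.subset_span ⟨lam, rfl⟩),
      sub_mem_degreeLT.2 fun d hd => ?_⟩
  have hcoeff : ∀ lam ∈ diagrams m,
      coeff d (b lam : MvPowerSeries ℕ K) = coeff d (schur K lam) := fun lam hlam =>
    sub_mem_degreeLT (g := schurFn K lam).1 (hb lam) d ((mem_diagrams.1 hlam).trans_le hd)
  rw [← Subalgebra.coe_val, map_sum, map_sum]
  simp only [map_smul, Subalgebra.coe_val, smul_eq_mul]
  rw [Finset.sum_congr rfl fun lam hlam => by rw [hcoeff lam hlam]]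
  rcases hd.eq_or_lt with rfl | hlt
  · exact coeff_eq_sum_schurCoeff (Subalgebra.inclusion (symmFn_le_completed K) f) d
  · rw [hf d hlt, Finset.sum_eq_zero fun lam hlam => ?_]
    rw [coeff_schur_of_degree_ne K ((mem_diagrams.1 hlam).trans_ne hlt.ne).symm, mul_zero]

theorem span_schurFn : Submodule.span K (Set.range (schurFn K)) = ⊤ :=
  span_range_eq_top fun lam => by simp only [sub_self, zero_mem]

theorem span_skewG_bot : Submodule.span K (Set.range fun lam => skewG K lam ⊥) = ⊤ := by
  refine span_range_eq_top fun lam => sub_mem_degreeLT.2 fun d hd => ?_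
  rw [coe_skewG bot_le]
  rcases hd.eq_or_lt with h | h
  · exact (coeff_schur_of_degree_eq K h.symm).symm
  · rw [coeff_dualGrothendieck_of_card_lt K (by rwa [skewCells_bot])]
    exact (coeff_schur_of_degree_ne K h.ne').symm

end Span

/-! ### Specialising one variable -/

theorem sum_antidiagonal_add_single {ι M : Type*} [DecidableEq ι] [AddCommMonoid M] {d : ι →₀ ℕ}
    {n : ι} (hn : d n = 0) (k : ℕ) (φ : (ι →₀ ℕ) → (ι →₀ ℕ) → M) :
    ∑ p ∈ Finset.HasAntidiagonal.antidiagonal (d + Finsupp.single n k), φ p.1 p.2 =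
      ∑ p ∈ Finset.HasAntidiagonal.antidiagonal d, ∑ q ∈ Finset.HasAntidiagonal.antidiagonal k,
        φ (p.1 + Finsupp.single n q.1) (p.2 + Finsupp.single n q.2) := by
  have herase {u : ι →₀ ℕ} (hu : u n = 0) (a : ℕ) : (u + Finsupp.single n a).erase n = u := by
    rw [Finsupp.erase_add, Finsupp.erase_single, add_zero,
      Finsupp.erase_of_notMem_support (Finsupp.notMem_support_iff.2 hu)]
  rw [← Finset.sum_product']
  refine Finset.sum_bij' (fun p _ => ((p.1.erase n, p.2.erase n), (p.1 n, p.2 n)))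
    (fun p _ => (p.1.1 + Finsupp.single n p.2.1, p.1.2 + Finsupp.single n p.2.2)) ?_ ?_ ?_ ?_ ?_
  · rintro ⟨u, v⟩ h
    rw [Finset.HasAntidiagonal.mem_antidiagonal] at h
    simp only [Finset.mem_product, Finset.HasAntidiagonal.mem_antidiagonal]
    exact ⟨by rw [← Finsupp.erase_add, h, herase hn], by simpa [hn] using DFunLike.congr_fun h n⟩
  · rintro ⟨⟨u, v⟩, ⟨a, b⟩⟩ h
    simp only [Finset.mem_product, Finset.HasAntidiagonal.mem_antidiagonal] at h ⊢
    rw [add_add_add_comm, ← Finsupp.single_add, h.1, h.2]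
  · rintro ⟨u, v⟩ -
    simp only [Finsupp.erase_add_single]
  · rintro ⟨⟨u, v⟩, ⟨a, b⟩⟩ h
    simp only [Finset.mem_product, Finset.HasAntidiagonal.mem_antidiagonal] at h
    have hzero : u n = 0 ∧ v n = 0 := by
      rw [← h.1] at hn
      exact Nat.add_eq_zero_iff.1 hn
    simp [herase hzero.1, herase hzero.2, hzero.1, hzero.2]
  · rintro ⟨u, v⟩ -
    simp only [Finsupp.erase_add_single]

section AdjoinVar

variable {K : Type*} [CommRing K]

theorem finite_support_coeff_add_single (f : SymmFn K) (n : ℕ) (d : ℕ →₀ ℕ) :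
    (Function.support fun k => coeff (d + Finsupp.single n k) (f : MvPowerSeries ℕ K)).Finite := by
  obtain ⟨m, hm⟩ := exists_mem_degreeLT f
  refine (Set.finite_lt_nat m).subset fun k hk => ?_
  by_contra! hmk
  refine hk (hm _ ?_)
  rw [map_add, Finsupp.degree_single]
  exact (not_lt.1 hmk).trans (Nat.le_add_left _ _)

/-- The terms of `f` whose exponents outside the variable `n` are those of `d`, as a polynomial in
that variable; it is used when `n` does not occur in `d`. -/
def slice (n : ℕ) (d : ℕ →₀ ℕ) : SymmFn K →ₗ[K] Polynomial K where
  toFun f := .ofFinsupp (.ofCoeff (Finsupp.ofSupportFinite _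
    (finite_support_coeff_add_single f n d)))
  map_add' f g := Polynomial.ext fun k =>
    map_add (coeff (d + Finsupp.single n k)) (f : MvPowerSeries ℕ K) g
  map_smul' r f := Polynomial.ext fun k =>
    map_smul (coeff (d + Finsupp.single n k)) r (f : MvPowerSeries ℕ K)

theorem coeff_slice (n : ℕ) (d : ℕ →₀ ℕ) (f : SymmFn K) (k : ℕ) :
    (slice n d f).coeff k = coeff (d + Finsupp.single n k) (f : MvPowerSeries ℕ K) :=
  rfl

theorem slice_mapDomain (σ : Equiv.Perm ℕ) (n : ℕ) (d : ℕ →₀ ℕ) (f : SymmFn K) :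
    slice (σ n) (d.mapDomain σ) f = slice n d f := by
  ext k
  rw [coeff_slice, coeff_slice, ← (mem_completed_iff _).1 f.2.1 σ (d + _), Finsupp.mapDomain_add,
    Finsupp.mapDomain_single]

theorem slice_eq_slice {d : ℕ →₀ ℕ} {m n : ℕ} (hm : d m = 0) (hn : d n = 0) (f : SymmFn K) :
    slice m d f = slice n d f := by
  have hswap : d.mapDomain (Equiv.swap n m) = d := by
    ext i
    rw [Finsupp.mapDomain_equiv_apply, Equiv.symm_swap, Equiv.swap_apply_def]
    split_ifs with hi hi <;> simp [hi, hm, hn]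
  simpa only [hswap, Equiv.swap_apply_left] using slice_mapDomain (Equiv.swap n m) n d f

theorem slice_mul {d : ℕ →₀ ℕ} {n : ℕ} (hn : d n = 0) (f g : SymmFn K) : slice n d (f * g) =
    ∑ p ∈ Finset.HasAntidiagonal.antidiagonal d, slice n p.1 f * slice n p.2 g := by
  ext k
  rw [coeff_slice, MulMemClass.coe_mul, coeff_mul, sum_antidiagonal_add_single hn k
    fun u v => coeff u (f : MvPowerSeries ℕ K) * coeff v (g : MvPowerSeries ℕ K)]
  simp only [Polynomial.finsetSum_coeff, Polynomial.coeff_mul, coeff_slice]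

theorem exists_apply_eq_zero (d : ℕ →₀ ℕ) : ∃ n, d n = 0 :=
  (Infinite.exists_notMem_finset d.support).imp fun _ => Finsupp.notMem_support_iff.1

/-- A variable that does not occur in the monomial with exponent vector `d`. -/
def fresh (d : ℕ →₀ ℕ) : ℕ := (exists_apply_eq_zero d).choose

theorem apply_fresh (d : ℕ →₀ ℕ) : d (fresh d) = 0 := (exists_apply_eq_zero d).choose_spec

theorem slice_eq_zero {m : ℕ} {f : SymmFn K} (hf : f ∈ degreeLT K m) {d : ℕ →₀ ℕ}
    (hd : m ≤ d.degree) (n : ℕ) : slice n d f = 0 := by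
  ext k
  rw [coeff_slice, hf _ (by rw [map_add]; exact hd.trans (Nat.le_add_right _ _)),
    Polynomial.coeff_zero]

theorem slice_eq_C {m : ℕ} {f : SymmFn K} (hf : f ∈ degreeLT K (m + 1)) {d : ℕ →₀ ℕ}
    (hd : m ≤ d.degree) (n : ℕ) :
    slice n d f = Polynomial.C (coeff d (f : MvPowerSeries ℕ K)) := by
  ext k
  rw [coeff_slice, Polynomial.coeff_C]
  split_ifs with hk
  · rw [hk, Finsupp.single_zero, add_zero]
  · exact hf _ (by rw [map_add, Finsupp.degree_single]; omega)

theorem one_mem_degreeLT : (1 : SymmFn K) ∈ degreeLT K 1 := fun d hd => by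
  classical
  rw [OneMemClass.coe_one, coeff_one, if_neg]
  rintro rfl
  exact Nat.not_succ_le_zero 0 (hd.trans_eq (map_zero _))

theorem eval_slice_mem (t : K) (f : SymmFn K) :
    (fun d => (slice (fresh d) d f).eval t : MvPowerSeries ℕ K) ∈ SymmFn K := by
  refine ⟨(mem_completed_iff _).2 fun σ d => congrArg (Polynomial.eval t) ?_, ?_⟩
  · rw [← slice_mapDomain σ (fresh d)]
    exact slice_eq_slice (apply_fresh _)
      ((Finsupp.mapDomain_apply σ.injective d _).trans (apply_fresh d)) f
  · exact (exists_mem_degreeLT f).imp fun m hm d hd =>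
      (congrArg (Polynomial.eval t) (slice_eq_zero hm hd.le _)).trans Polynomial.eval_zero

theorem eval_slice_mul (t : K) (f g : SymmFn K) (d : ℕ →₀ ℕ) :
    (slice (fresh d) d (f * g)).eval t = ∑ p ∈ Finset.HasAntidiagonal.antidiagonal d,
      (slice (fresh p.1) p.1 f).eval t * (slice (fresh p.2) p.2 g).eval t := by
  rw [slice_mul (apply_fresh d), Polynomial.eval_finsetSum]
  refine Finset.sum_congr rfl fun p hp => ?_
  have hzero : p.1 (fresh d) = 0 ∧ p.2 (fresh d) = 0 := by
    rw [← Nat.add_eq_zero_iff, ← Finsupp.add_apply, Finset.HasAntidiagonal.mem_antidiagonal.1 hp,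
      apply_fresh]
  rw [Polynomial.eval_mul, slice_eq_slice hzero.1 (apply_fresh p.1),
    slice_eq_slice hzero.2 (apply_fresh p.2)]

/-- The algebra homomorphism of the ring of symmetric functions that adjoins a variable and gives
it the value `t`. By symmetry, any variable not occurring in a monomial can play the role of the
new one in the computation of the coefficient of that monomial. -/
def adjoinVar (t : K) : SymmFn K →ₐ[K] SymmFn K :=
  AlgHom.ofLinearMap
    { toFun f := ⟨_, eval_slice_mem t f⟩
      map_add' f g := Subtype.ext <| MvPowerSeries.ext fun d => by
        change Polynomial.eval t _ = Polynomial.eval t _ + Polynomial.eval t _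
        rw [map_add, Polynomial.eval_add]
      map_smul' r f := Subtype.ext <| MvPowerSeries.ext fun d => by
        change Polynomial.eval t _ = r * Polynomial.eval t _
        rw [map_smul, Polynomial.eval_smul, smul_eq_mul] }
    (Subtype.ext <| MvPowerSeries.ext fun d => (congrArg (Polynomial.eval t)
      (slice_eq_C one_mem_degreeLT (Nat.zero_le _) _)).trans (Polynomial.eval_C))
    fun f g => Subtype.ext <| MvPowerSeries.ext fun d => by
      rw [MulMemClass.coe_mul, coeff_mul]
      exact eval_slice_mul t f g d

theorem coeff_adjoinVar (t : K) (f : SymmFn K) {d : ℕ →₀ ℕ} {n : ℕ} (hn : d n = 0) :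
    coeff d (adjoinVar t f : MvPowerSeries ℕ K) = (slice n d f).eval t :=
  congrArg (Polynomial.eval t) (slice_eq_slice (apply_fresh d) hn f)

theorem adjoinVar_sub_mem_degreeLT (t : K) {m : ℕ} {f : SymmFn K} (hf : f ∈ degreeLT K (m + 1)) :
    adjoinVar t f - f ∈ degreeLT K m :=
  sub_mem_degreeLT.2 fun d hd => by
    rw [coeff_adjoinVar t f (apply_fresh d), slice_eq_C hf hd, Polynomial.eval_C]

/-- Adjoining a variable with the value `t`, as an automorphism of the ring of symmetric
functions. -/
def adjoinVarEquiv (t : K) : SymmFn K ≃ₐ[K] SymmFn K :=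
  AlgEquiv.ofBijective (adjoinVar t) <|
    bijective_of_forall_sub_mem (F := degreeLT K) (φ := (adjoinVar t).toLinearMap) degreeLT_zero
      exists_mem_degreeLT fun _ _ => adjoinVar_sub_mem_degreeLT t

end AdjoinVar

/-! ### Branching rules -/

section Branching

variable {K : Type*} [CommRing K]

theorem numCols_add_card_le {lam nu : YoungDiagram} (h : nu ≤ lam) :
    numCols lam nu + nu.card ≤ lam.card :=
  (Nat.add_le_add_right Finset.card_image_le _).trans_eq
    (Finset.card_sdiff_add_card_eq_card (YoungDiagram.cells_subset_iff.2 h))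

theorem coeff_skewG {lam mu : YoungDiagram} (h : mu ≤ lam) (d : ℕ →₀ ℕ) :
    coeff d (skewG K lam mu : MvPowerSeries ℕ K) = (colProd d mu lam : K) := by
  rw [coe_skewG h, coeff_dualGrothendieck K h]

theorem slice_skewG_right {lam mu : YoungDiagram} (h : mu ≤ lam) {d : ℕ →₀ ℕ} {n : ℕ}
    (hn : d n = 0) : slice n d (skewG K lam mu) = ∑ nu ∈ Finset.Icc mu lam,
      Polynomial.monomial (numCols lam nu) (coeff d (skewG K nu mu : MvPowerSeries ℕ K)) := by
  ext k
  rw [coeff_slice, coeff_skewG h, colProd_add_single hn, IncidenceAlgebra.mul_apply, Nat.cast_sum,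
    Polynomial.finsetSum_coeff]
  refine Finset.sum_congr rfl fun nu hnu => ?_
  rw [Finset.mem_Icc] at hnu
  rw [colOp_apply hnu.2, coeff_skewG hnu.1, Polynomial.coeff_monomial, mul_ite, mul_one, mul_zero,
    Nat.cast_ite, Nat.cast_zero]

theorem slice_skewG_left {lam mu : YoungDiagram} (h : mu ≤ lam) {d : ℕ →₀ ℕ} {n : ℕ}
    (hn : d n = 0) : slice n d (skewG K lam mu) = ∑ nu ∈ Finset.Icc mu lam,
      Polynomial.monomial (numCols nu mu) (coeff d (skewG K lam nu : MvPowerSeries ℕ K)) := by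
  ext k
  rw [coeff_slice, coeff_skewG h, colProd_add_single hn, (commute_colProd_colOp d k).eq,
    IncidenceAlgebra.mul_apply, Nat.cast_sum, Polynomial.finsetSum_coeff]
  refine Finset.sum_congr rfl fun nu hnu => ?_
  rw [Finset.mem_Icc] at hnu
  rw [colOp_apply hnu.1, coeff_skewG hnu.2, Polynomial.coeff_monomial, ite_mul, one_mul, zero_mul,
    Nat.cast_ite, Nat.cast_zero]

theorem coeff_schur_eq_ite {nu : YoungDiagram} (d : ℕ →₀ ℕ) : coeff d (schur K nu) =
    if d.degree = nu.card then coeff d (skewG K nu ⊥ : MvPowerSeries ℕ K) else 0 := by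
  rw [coe_skewG bot_le]
  split_ifs with hd
  · exact coeff_schur_of_degree_eq K hd
  · exact coeff_schur_of_degree_ne K hd

theorem coeff_skewG_bot_of_card_lt {nu : YoungDiagram} {d : ℕ →₀ ℕ} (h : nu.card < d.degree) :
    coeff d (skewG K nu ⊥ : MvPowerSeries ℕ K) = 0 := by
  rw [coe_skewG bot_le]
  exact coeff_dualGrothendieck_of_card_lt K (by rwa [skewCells_bot])

theorem slice_schurFn (lam : YoungDiagram) {d : ℕ →₀ ℕ} {n : ℕ} (hn : d n = 0) :
    slice n d (schurFn K lam) =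
      ∑ nu ∈ Finset.Icc ⊥ lam with numCols lam nu + nu.card = lam.card,
        Polynomial.monomial (numCols lam nu) (coeff d (schurFn K nu : MvPowerSeries ℕ K)) := by
  ext k
  have hdeg : (d + Finsupp.single n k).degree = d.degree + k := by
    rw [map_add, Finsupp.degree_single]
  have hterm : ∀ nu ∈ Finset.Icc ⊥ lam,
      (if numCols lam nu + nu.card = lam.card then
        (Polynomial.monomial (numCols lam nu) (coeff d (schur K nu))).coeff k else 0) =
      if d.degree + k = lam.card then (Polynomial.monomial (numCols lam nu)
        (coeff d (skewG K nu ⊥ : MvPowerSeries ℕ K))).coeff k else 0 := fun nu hnu => by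
    have hle := numCols_add_card_le (Finset.mem_Icc.1 hnu).2
    have hzero := coeff_skewG_bot_of_card_lt (K := K) (nu := nu) (d := d)
    rw [Polynomial.coeff_monomial, Polynomial.coeff_monomial, coeff_schur_eq_ite]
    split_ifs <;> first | rfl | omega | exact (hzero (by omega)).symm
  calc (slice n d (schurFn K lam)).coeff k
    _ = if d.degree + k = lam.card then (slice n d (skewG K lam ⊥)).coeff k else 0 := by
      rw [coeff_slice, coeff_slice, schurFn, coeff_schur_eq_ite, hdeg]
    _ = _ := by
      rw [slice_skewG_right bot_le hn, Polynomial.finsetSum_coeff, Polynomial.finsetSum_coeff,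
        Finset.sum_filter, Finset.ite_sum_zero]
      exact Finset.sum_congr rfl fun nu hnu => (hterm nu hnu).symm

theorem adjoinVar_eq_sum {ι : Type*} {s : Finset ι} {f : SymmFn K} {c : ι → ℕ} {g : ι → SymmFn K}
    (h : ∀ (d : ℕ →₀ ℕ) (n : ℕ), d n = 0 → slice n d f =
      ∑ i ∈ s, Polynomial.monomial (c i) (coeff d (g i : MvPowerSeries ℕ K))) (t : K) :
    adjoinVar t f = ∑ i ∈ s, t ^ c i • g i := by
  refine Subtype.ext (MvPowerSeries.ext fun d => ?_)
  rw [coeff_adjoinVar t f (apply_fresh d), h d _ (apply_fresh d), Polynomial.eval_finsetSum,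
    AddSubmonoidClass.coe_finsetSum, map_sum]
  refine Finset.sum_congr rfl fun i _ => ?_
  rw [Polynomial.eval_monomial, SetLike.val_smul, map_smul, smul_eq_mul, mul_comm]

theorem adjoinVar_skewG_right {lam mu : YoungDiagram} (h : mu ≤ lam) (t : K) :
    adjoinVar t (skewG K lam mu) =
      ∑ nu ∈ Finset.Icc mu lam, t ^ numCols lam nu • skewG K nu mu :=
  adjoinVar_eq_sum (fun _ _ => slice_skewG_right h) t

theorem adjoinVar_skewG_left {lam mu : YoungDiagram} (h : mu ≤ lam) (t : K) :
    adjoinVar t (skewG K lam mu) =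
      ∑ nu ∈ Finset.Icc mu lam, t ^ numCols nu mu • skewG K lam nu :=
  adjoinVar_eq_sum (fun _ _ => slice_skewG_left h) t

theorem adjoinVar_schurFn (lam : YoungDiagram) (t : K) :
    adjoinVar t (schurFn K lam) =
      ∑ nu ∈ Finset.Icc ⊥ lam with numCols lam nu + nu.card = lam.card,
        t ^ numCols lam nu • schurFn K nu :=
  adjoinVar_eq_sum (fun _ _ => slice_schurFn lam) t

end Branching

/-! ### The Hall pairing with `E (-t)` -/

section ColumnShapes

/-- The Young diagram with a single column, of length `k`. -/
def column (k : ℕ) : YoungDiagram := consCol k ⊥ ((colLen_bot 0).trans_le (Nat.zero_le k))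

@[simp]
theorem colLen_zero_column (k : ℕ) : (column k).colLen 0 = k := colLen_consCol_zero

@[simp]
theorem dropCol_column (k : ℕ) : dropCol (column k) = ⊥ := dropCol_consCol

@[simp]
theorem dropCol_bot : dropCol ⊥ = ⊥ :=
  le_bot_iff.1 fun _ hc => (YoungDiagram.notMem_bot _ (mem_dropCol.1 hc)).elim

@[simp]
theorem card_column (k : ℕ) : (column k).card = k := by
  simp [card_eq_colLen_zero_add_card_dropCol (column k)]

theorem column_colLen_zero {nu : YoungDiagram} (h : dropCol nu = ⊥) :
    column (nu.colLen 0) = nu :=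
  eq_iff_colLen_zero_eq_and_dropCol_eq.2 ⟨colLen_zero_column _, (dropCol_column _).trans h.symm⟩

theorem column_le_iff {k : ℕ} {lam : YoungDiagram} : column k ≤ lam ↔ k ≤ lam.colLen 0 :=
  consCol_le_iff.trans (and_iff_left bot_le)

theorem numCols_column (lam : YoungDiagram) (k : ℕ) : numCols lam (column k) =
    (if k < lam.colLen 0 then 1 else 0) + numCols (dropCol lam) ⊥ := by
  rw [numCols_eq_add_numCols_dropCol, colLen_zero_column, dropCol_column]

theorem numCols_column_add_card_eq_iff {lam : YoungDiagram} {k : ℕ} (hk : k ≤ lam.colLen 0) :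
    numCols lam (column k) + (column k).card = lam.card ↔
      lam.colLen 0 ≤ k + 1 ∧ numCols (dropCol lam) ⊥ = (dropCol lam).card := by
  have hle := numCols_add_card_le (bot_le : ⊥ ≤ dropCol lam)
  rw [numCols_column, card_column, card_eq_colLen_zero_add_card_dropCol lam]
  split_ifs <;> omega

open Classical in
theorem sum_Icc_bot_filter_dropCol {M : Type*} [AddCommMonoid M] (lam : YoungDiagram)
    (f : YoungDiagram → M) : ∑ nu ∈ Finset.Icc ⊥ lam with dropCol nu = ⊥, f nu =
      ∑ k ∈ Finset.range (lam.colLen 0 + 1), f (column k) := by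
  have himage : (Finset.Icc ⊥ lam).filter (dropCol · = ⊥) =
      (Finset.range (lam.colLen 0 + 1)).image column := by
    ext nu
    simp only [Finset.mem_filter, Finset.mem_Icc, bot_le, true_and, Finset.mem_image,
      Finset.mem_range, Nat.lt_succ_iff]
    constructor
    · exact fun ⟨hle, hnu⟩ => ⟨nu.colLen 0, le_iff_colLen_le.1 hle 0, column_colLen_zero hnu⟩
    · rintro ⟨k, hk, rfl⟩
      exact ⟨column_le_iff.2 hk, dropCol_column k⟩
  rw [himage, Finset.sum_image fun k _ l _ h => by simpa using congrArg YoungDiagram.card h]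

end ColumnShapes

section ElementarySeries

variable {K : Type*} [CommRing K]

open Classical in
/-- The coefficients of `E (t)` in the Schur basis: `e_k` is the Schur function of a column. -/
def elemCoeff (t : K) (lam : YoungDiagram) : K := if dropCol lam = ⊥ then t ^ lam.card else 0

theorem dropCol_eq_bot_iff {nu : YoungDiagram} : dropCol nu = ⊥ ↔ ∀ i, rowVec nu i ≤ 1 := by
  simp only [rowVec_apply, ← not_lt, ← YoungDiagram.mem_iff_lt_rowLen]
  refine ⟨fun h i hi => YoungDiagram.notMem_bot (i, 0) (h ▸ mem_dropCol.2 hi), fun h => ?_⟩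
  refine le_bot_iff.1 fun ⟨i, j⟩ hij => (h i ?_).elim
  exact nu.up_left_mem le_rfl (Nat.succ_le_succ (Nat.zero_le j)) (mem_dropCol.1 hij)

theorem content_le_one {lam : YoungDiagram} (h : dropCol lam = ⊥)
    (T : SemistandardYoungTableau lam) (i : ℕ) : content T i ≤ 1 := by
  rw [← ReversePlanePartition.weight_ofTableau, ReversePlanePartition.weight_apply]
  refine Finset.card_le_one_iff_subset_singleton.2 ⟨0, fun j hj => ?_⟩
  obtain ⟨⟨a, b⟩, hc, rfl⟩ := Finset.mem_image.1 hj
  have hmem := (mem_skewCells.1 (Finset.mem_filter.1 hc).1).1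
  rcases b with _ | b
  · exact Finset.mem_singleton_self 0
  · exact (YoungDiagram.notMem_bot (a, b) (h ▸ mem_dropCol.2 hmem)).elim

open Classical in
theorem coeff_elemSeries (t : K) (d : ℕ →₀ ℕ) :
    coeff d (elemSeries t) = if ∀ k, d k ≤ 1 then t ^ d.degree else 0 := by
  change ∑ᶠ i : ℕ, t ^ i * (if d.degree = i ∧ ∀ k, d k ≤ 1 then (1 : K) else 0) = _
  rw [finsum_eq_single _ d.degree fun i hi => by rw [if_neg fun h => hi h.1.symm, mul_zero]]
  simp only [true_and, mul_ite, mul_one, mul_zero]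

theorem elemCoeff_mul_coeff_rowVec_schur (t : K) {lam mu : YoungDiagram}
    (hcard : lam.card = mu.card) (hne : lam ≠ mu) :
    elemCoeff t lam * coeff (rowVec mu) (schur K lam) = 0 := by
  by_contra hmul
  have hlam : dropCol lam = ⊥ := by
    by_contra h
    exact left_ne_zero_of_mul hmul (if_neg h)
  obtain ⟨T, hT⟩ := exists_content_eq_of_coeff_schur_ne_zero (right_ne_zero_of_mul hmul)
  have hmu : dropCol mu = ⊥ := dropCol_eq_bot_iff.2 fun i => hT ▸ content_le_one hlam T i
  refine hne (eq_iff_colLen_zero_eq_and_dropCol_eq.2 ⟨?_, hlam.trans hmu.symm⟩)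
  rw [card_eq_colLen_zero_add_card_dropCol lam, card_eq_colLen_zero_add_card_dropCol mu, hlam,
    hmu] at hcard
  exact Nat.add_right_cancel hcard

theorem schurCoeff_E (t : K) : schurCoeff (E t) = elemCoeff t := by
  classical
  refine schurCoeff_eq_iff.2 (completed_ext fun mu => ?_)
  rw [coeff_schurSum, degree_rowVec, Finset.sum_eq_single mu
    (fun lam hlam => elemCoeff_mul_coeff_rowVec_schur t (mem_diagrams.1 hlam))
    (fun h => absurd (mem_diagrams.2 rfl) h), coeff_rowVec_schur_self, mul_one]
  change elemCoeff t mu = coeff (rowVec mu) (elemSeries t)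
  simp only [coeff_elemSeries, elemCoeff, dropCol_eq_bot_iff, degree_rowVec]

open Classical in
theorem sum_pow_numCols_mul_elemCoeff (t : K) (lam : YoungDiagram) :
    ∑ nu ∈ Finset.Icc ⊥ lam with numCols lam nu + nu.card = lam.card,
      t ^ numCols lam nu * elemCoeff (-t) nu = if lam = ⊥ then 1 else 0 := by
  have hcolumns : ∑ nu ∈ Finset.Icc ⊥ lam with numCols lam nu + nu.card = lam.card,
      t ^ numCols lam nu * elemCoeff (-t) nu = ∑ k ∈ Finset.range (lam.colLen 0 + 1),
        if lam.colLen 0 ≤ k + 1 ∧ numCols (dropCol lam) ⊥ = (dropCol lam).card then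
          t ^ numCols lam (column k) * (-t) ^ k else 0 := by
    simp only [elemCoeff, mul_ite, mul_zero]
    rw [← Finset.sum_filter, Finset.filter_comm, Finset.sum_filter, sum_Icc_bot_filter_dropCol]
    refine Finset.sum_congr rfl fun k hk => ?_
    have hiff := numCols_column_add_card_eq_iff (Nat.lt_succ_iff.1 (Finset.mem_range.1 hk))
    rw [card_column] at hiff
    simp only [card_column, hiff]
  rw [hcolumns]
  split_ifs with hlam
  · subst hlam
    simp only [colLen_bot, zero_add, Finset.sum_range_one, dropCol_bot,
      numCols_eq_zero_iff.2 (bot_le : (⊥ : YoungDiagram) ≤ _), pow_zero, mul_one, zero_le, true_and]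
    exact if_pos rfl
  by_cases hrest : numCols (dropCol lam) ⊥ = (dropCol lam).card
  · obtain ⟨l, hl⟩ := Nat.exists_eq_succ_of_ne_zero (colLen_zero_pos hlam).ne'
    have htail : ∑ k ∈ Finset.range l, (if l + 1 ≤ k + 1 then
        t ^ numCols lam (column k) * (-t) ^ k else 0) = 0 := Finset.sum_eq_zero fun k hk =>
      if_neg fun h => (Finset.mem_range.1 hk).not_ge (Nat.le_of_succ_le_succ h)
    simp only [hl, hrest, and_true, Finset.sum_range_succ, Nat.succ_eq_add_one, htail]
    rw [if_pos le_rfl, if_pos (Nat.le_succ _), numCols_column, numCols_column, hl,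
      if_pos l.lt_succ_self, if_neg (lt_irrefl _)]
    ring
  · simp only [hrest, and_false, if_false, Finset.sum_const_zero]

end ElementarySeries

section Hall

variable {K : Type*} [CommRing K]

open Classical in
theorem schurCoeff_schurFn (lam : YoungDiagram) :
    schurCoeff (Subalgebra.inclusion (symmFn_le_completed K) (schurFn K lam)) =
      Pi.single lam 1 := by
  refine schurCoeff_eq_iff.2 (Subtype.ext (MvPowerSeries.ext fun d => ?_))
  change _ = coeff d (schur K lam)
  simp only [coeff_schurSum, Pi.single_apply, ite_mul, one_mul, zero_mul, Finset.sum_ite_eq',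
    mem_diagrams]
  exact ite_eq_left_iff.2 fun h => (coeff_schur_of_degree_ne K (Ne.symm h)).symm

theorem finite_support_schurCoeff (f : SymmFn K) :
    (schurCoeff (Subalgebra.inclusion (symmFn_le_completed K) f)).support.Finite := by
  classical
  have hf : f ∈ Submodule.span K (Set.range (schurFn K)) :=
    (span_schurFn (K := K)).symm ▸ Submodule.mem_top
  induction hf using Submodule.span_induction with
  | mem _ h =>
    obtain ⟨lam, rfl⟩ := h
    rw [schurCoeff_schurFn]
    exact (Set.finite_singleton lam).subset Pi.support_single_subset
  | zero =>
    rw [map_zero, schurCoeff_eq_schurEquiv_symm, map_zero, Function.support_zero]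
    exact Set.finite_empty
  | add f g _ _ hf hg =>
    rw [schurCoeff_eq_schurEquiv_symm] at hf hg ⊢
    rw [map_add, map_add]
    exact (hf.union hg).subset (Function.support_add _ _)
  | smul a f _ hf =>
    rw [schurCoeff_eq_schurEquiv_symm] at hf ⊢
    rw [map_smul, map_smul]
    exact hf.subset (Function.support_const_smul_subset a _)

theorem finite_support_hall (F : Completed K) (f : SymmFn K) : (fun lam => schurCoeff F lam *
    schurCoeff (Subalgebra.inclusion (symmFn_le_completed K) f) lam).support.Finite :=
  (finite_support_schurCoeff f).subset (Function.support_mul_subset_right _ _)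

/-- The Hall pairing with `F`, as a linear map. -/
def hallLin (F : Completed K) : SymmFn K →ₗ[K] K where
  toFun := hall F
  map_add' f g := by
    have hadd : schurCoeff (Subalgebra.inclusion (symmFn_le_completed K) (f + g)) =
        schurCoeff (Subalgebra.inclusion (symmFn_le_completed K) f) +
          schurCoeff (Subalgebra.inclusion (symmFn_le_completed K) g) := by
      simp only [schurCoeff_eq_schurEquiv_symm, map_add]
    refine Eq.trans (finsum_congr fun lam => ?_) 
      (finsum_add_distrib (finite_support_hall F f) (finite_support_hall F g))
    exact (congrArg (schurCoeff F lam * ·) (congrFun hadd lam)).trans (mul_add _ _ _)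
  map_smul' a f := by
    have hsmul : schurCoeff (Subalgebra.inclusion (symmFn_le_completed K) (a • f)) =
        a • schurCoeff (Subalgebra.inclusion (symmFn_le_completed K) f) := by
      simp only [schurCoeff_eq_schurEquiv_symm, map_smul]
    refine Eq.trans (finsum_congr fun lam => ?_) (smul_finsum' a (finite_support_hall F f)).symm
    exact (congrArg (schurCoeff F lam * ·) (congrFun hsmul lam)).trans (mul_left_comm _ _ _)

theorem hallLin_schurFn (F : Completed K) (lam : YoungDiagram) :
    hallLin F (schurFn K lam) = schurCoeff F lam := by
  classical
  change ∑ᶠ nu, schurCoeff F nu *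
    schurCoeff (Subalgebra.inclusion (symmFn_le_completed K) (schurFn K lam)) nu = _
  rw [schurCoeff_schurFn, finsum_eq_single _ lam fun nu hnu => by
    rw [Pi.single_eq_of_ne hnu, mul_zero], Pi.single_eq_same, mul_one]

/-- The constant coefficient, as an algebra homomorphism. -/
def constHom (K : Type*) [CommRing K] : SymmFn K →ₐ[K] K :=
  AlgHom.ofLinearMap (coeff (R := K) (0 : ℕ →₀ ℕ) ∘ₗ (SymmFn K).val.toLinearMap)
    (by simp) fun f g => by simp

theorem constHom_apply (f : SymmFn K) :
    constHom K f = coeff 0 (f : MvPowerSeries ℕ K) := rfl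

open Classical in
theorem constHom_schurFn (lam : YoungDiagram) :
    constHom K (schurFn K lam) = if lam = ⊥ then 1 else 0 := by
  change coeff 0 (schur K lam) = _
  split_ifs with h
  · rw [h]
    exact coeff_rowVec_schur_self K ⊥
  · refine coeff_schur_of_degree_ne K fun hdeg => h (YoungDiagram.ext ?_)
    exact Finset.card_eq_zero.1 (hdeg.symm.trans (map_zero _))

theorem hallLin_E_neg_adjoinVar (t : K) (f : SymmFn K) :
    hallLin (E (-t)) (adjoinVar t f) = constHom K f := by
  classical
  suffices h : hallLin (E (-t)) ∘ₗ (adjoinVar t).toLinearMap = (constHom K).toLinearMap from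
    LinearMap.congr_fun h f
  refine LinearMap.ext_on_range span_schurFn fun lam => ?_
  change hallLin (E (-t)) (adjoinVar t (schurFn K lam)) = constHom K (schurFn K lam)
  rw [adjoinVar_schurFn, constHom_schurFn, ← sum_pow_numCols_mul_elemCoeff t, map_sum]
  simp only [map_smul, hallLin_schurFn, schurCoeff_E, smul_eq_mul]

theorem hall_E_neg (t : K) (f : SymmFn K) :
    hall (E (-t)) f = constHom K ((adjoinVarEquiv t).symm f) := by
  rw [← hallLin_E_neg_adjoinVar t]
  exact congrArg (hall (E (-t))) ((adjoinVarEquiv t).apply_symm_apply f).symm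

end Hall

/-! ### The Möbius function of Young's lattice -/

section Mobius

open Classical in
/-- The removable corners of a Young diagram, as a set of cells. -/
def corners (lam : YoungDiagram) : Finset (ℕ × ℕ) :=
  lam.cells.filter fun c => (c.1 + 1, c.2) ∉ lam ∧ (c.1, c.2 + 1) ∉ lam

theorem mem_corners {lam : YoungDiagram} {c : ℕ × ℕ} :
    c ∈ corners lam ↔ c ∈ lam ∧ (c.1 + 1, c.2) ∉ lam ∧ (c.1, c.2 + 1) ∉ lam :=
  Finset.mem_filter

theorem isRookStrip_iff_subset_corners {lam mu : YoungDiagram} :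
    IsRookStrip lam mu ↔ skewCells lam mu ⊆ corners lam :=
  forall₂_congr fun _ hc => (and_iff_right (mem_skewCells.1 hc).1).symm.trans mem_corners.symm

theorem corners_sdiff_cells_nonempty {lam mu : YoungDiagram} (h : ¬lam ≤ mu) :
    (corners lam \ mu.cells).Nonempty := by
  have hskew : (skewCells lam mu).Nonempty := Finset.sdiff_nonempty.2 h
  obtain ⟨⟨i, j⟩, hc, hmax⟩ := Finset.exists_maximal hskew
  rw [mem_skewCells] at hc
  have hout {a b : ℕ} (hlam : (a, b) ∈ lam) (hle : (i, j) ≤ (a, b)) : (a, b) ≤ (i, j) :=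
    hmax (mem_skewCells.2 ⟨hlam, fun hmu => hc.2 (mu.up_left_mem hle.1 hle.2 hmu)⟩) hle
  refine ⟨(i, j), Finset.mem_sdiff.2 ⟨mem_corners.2 ⟨hc.1, fun hlam => ?_, fun hlam => ?_⟩, hc.2⟩⟩
  · exact i.not_succ_le_self (hout hlam ⟨i.le_succ, le_rfl⟩).1
  · exact j.not_succ_le_self (hout hlam ⟨le_rfl, j.le_succ⟩).2

/-- The Young diagram obtained by removing a set of removable corners. -/
def removeCorners (lam : YoungDiagram) (s : Finset (ℕ × ℕ)) (hs : s ⊆ corners lam) :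
    YoungDiagram where
  cells := lam.cells \ s
  isLowerSet := by
    rintro ⟨i, j⟩ ⟨i', j'⟩ hle hc
    obtain ⟨hi, hj⟩ : i' ≤ i ∧ j' ≤ j := hle
    obtain ⟨hlam, hnot⟩ := Finset.mem_sdiff.1 hc
    refine Finset.mem_sdiff.2 ⟨lam.up_left_mem hi hj hlam, fun hmem => ?_⟩
    obtain ⟨-, hdown, hright⟩ := mem_corners.1 (hs hmem)
    rcases hi.eq_or_lt with rfl | hi
    · rcases hj.eq_or_lt with rfl | hj
      · exact hnot hmem
      · exact hright (lam.up_left_mem le_rfl hj hlam)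
    · exact hdown (lam.up_left_mem hi hj hlam)

theorem skewCells_removeCorners {lam : YoungDiagram} {s : Finset (ℕ × ℕ)} (hs : s ⊆ corners lam) :
    skewCells lam (removeCorners lam s hs) = s :=
  Finset.sdiff_sdiff_eq_self (hs.trans (Finset.filter_subset _ _))

open Classical in
theorem sum_neg_one_pow_rookStrip {kap lam : YoungDiagram} (h : kap ≤ lam) :
    ∑ nu ∈ Finset.Icc kap lam with IsRookStrip lam nu, (-1 : ℤ) ^ (skewCells lam nu).card =
      if kap = lam then 1 else 0 := by
  have hcorners {s : Finset (ℕ × ℕ)} (hs : s ∈ (corners lam \ kap.cells).powerset) :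
      s ⊆ corners lam := (Finset.mem_powerset.1 hs).trans Finset.sdiff_subset
  calc ∑ nu ∈ Finset.Icc kap lam with IsRookStrip lam nu, (-1 : ℤ) ^ (skewCells lam nu).card
    _ = ∑ s ∈ (corners lam \ kap.cells).powerset, (-1 : ℤ) ^ s.card := by
      refine Finset.sum_bij' (fun nu _ => skewCells lam nu)
        (fun s hs => removeCorners lam s (hcorners hs)) (fun nu hnu => ?_) (fun s hs => ?_)
        (fun nu hnu => ?_) (fun s hs => skewCells_removeCorners (hcorners hs)) fun _ _ => rfl
      · rw [Finset.mem_filter, Finset.mem_Icc, isRookStrip_iff_subset_corners] at hnu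
        exact Finset.mem_powerset.2 fun c hc => Finset.mem_sdiff.2
          ⟨hnu.2 hc, fun hkap => (mem_skewCells.1 hc).2 (hnu.1.1 hkap)⟩
      · rw [Finset.mem_filter, Finset.mem_Icc, isRookStrip_iff_subset_corners,
          skewCells_removeCorners]
        refine ⟨⟨fun c hc => Finset.mem_sdiff.2 ⟨h hc, fun hmem => ?_⟩, Finset.sdiff_subset⟩,
          hcorners hs⟩
        exact (Finset.mem_sdiff.1 (Finset.mem_powerset.1 hs hmem)).2 hc
      · exact YoungDiagram.ext (Finset.sdiff_sdiff_eq_self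
          (YoungDiagram.cells_subset_iff.2 (Finset.mem_Icc.1 (Finset.mem_filter.1 hnu).1).2))
    _ = if corners lam \ kap.cells = ∅ then 1 else 0 := Finset.sum_powerset_neg_one_pow_card
    _ = if kap = lam then 1 else 0 := by
      refine if_congr ⟨fun hempty => h.antisymm ?_, ?_⟩ rfl rfl
      · exact not_not.1 fun hle => (corners_sdiff_cells_nonempty hle).ne_empty hempty
      · rintro rfl
        exact Finset.sdiff_eq_empty_iff_subset.2 (Finset.filter_subset _ _)

open Classical in
/-- The signed indicator function of rook strips, as an element of the incidence algebra. -/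
def rookSign : IncidenceAlgebra ℤ YoungDiagram where
  toFun mu lam := if mu ≤ lam ∧ IsRookStrip lam mu then (-1) ^ (skewCells lam mu).card else 0
  eq_zero_of_not_le' _ _ h := if_neg fun hand => h hand.1

open Classical in
theorem rookSign_apply {mu lam : YoungDiagram} (h : mu ≤ lam) :
    rookSign mu lam = if IsRookStrip lam mu then (-1) ^ (skewCells lam mu).card else 0 :=
  if_congr (and_iff_right h) rfl rfl

open Classical in
theorem zeta_mul_rookSign :
    IncidenceAlgebra.zeta ℤ * rookSign = (1 : IncidenceAlgebra ℤ YoungDiagram) := by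
  refine IncidenceAlgebra.ext fun kap lam h => ?_
  rw [IncidenceAlgebra.mul_apply, IncidenceAlgebra.one_apply, ← sum_neg_one_pow_rookStrip h,
    Finset.sum_filter]
  refine Finset.sum_congr rfl fun nu hnu => ?_
  rw [Finset.mem_Icc] at hnu
  rw [IncidenceAlgebra.zeta_of_le hnu.1, one_mul, rookSign_apply hnu.2]

open Classical in
theorem mu_eq_rookSign : IncidenceAlgebra.mu ℤ = rookSign :=
  left_inv_eq_right_inv (IncidenceAlgebra.mu_mul_zeta ℤ YoungDiagram) zeta_mul_rookSign

theorem isRookStrip_bot_iff {lam : YoungDiagram} : IsRookStrip lam ⊥ ↔ lam.card ≤ 1 := by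
  rw [IsRookStrip, skewCells_bot]
  constructor
  · intro h
    refine (Finset.card_le_card (t := {(0, 0)}) ?_).trans (Finset.card_singleton _).le
    rintro ⟨i, j⟩ hc
    have hcorner := h (0, 0) (lam.up_left_mem i.zero_le j.zero_le hc)
    rcases i with _ | i
    · rcases j with _ | j
      · exact Finset.mem_singleton_self _
      · exact (hcorner.2 (lam.up_left_mem le_rfl (Nat.succ_le_succ j.zero_le) hc)).elim
    · exact (hcorner.1 (lam.up_left_mem (Nat.succ_le_succ i.zero_le) j.zero_le hc)).elim
  · intro h c hc
    have hunique := Finset.card_le_one.1 h c hc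
    exact ⟨fun hdown => (Nat.succ_ne_self _).symm (congrArg Prod.fst (hunique _ hdown)),
      fun hright => (Nat.succ_ne_self _).symm (congrArg Prod.snd (hunique _ hright))⟩

end Mobius

/-! ### Möbius inversion -/

section Inversion

variable {P R M : Type*} [PartialOrder P] [LocallyFiniteOrder P] [DecidableEq P] [Ring R]
  [AddCommGroup M] [Module R M] {a b : P}

variable (R) in
theorem sum_Icc_mu_smul_sum_Icc_left (h : a ≤ b) (v : P → M) :
    ∑ c ∈ Finset.Icc a b, IncidenceAlgebra.mu R c b • ∑ e ∈ Finset.Icc a c, v e = v b := by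
  simp only [Finset.smul_sum]
  rw [Finset.sum_comm' (t' := Finset.Icc a b) (s' := fun e => Finset.Icc e b) fun c e => ?_]
  · simp only [← Finset.sum_smul, IncidenceAlgebra.sum_Icc_mu_left, ite_smul, one_smul, zero_smul,
      Finset.sum_ite_eq', Finset.right_mem_Icc.2 h, if_true]
  · simp only [Finset.mem_Icc]
    exact ⟨fun ⟨hc, he⟩ => ⟨⟨he.2, hc.2⟩, he.1, he.2.trans hc.2⟩,
      fun ⟨hc, he⟩ => ⟨⟨he.1.trans hc.1, hc.2⟩, he.1, hc.1⟩⟩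

variable (R) in
theorem sum_Icc_mu_smul_sum_Icc_right (h : a ≤ b) (v : P → M) :
    ∑ c ∈ Finset.Icc a b, IncidenceAlgebra.mu R a c • ∑ e ∈ Finset.Icc c b, v e = v a := by
  simp only [Finset.smul_sum]
  rw [Finset.sum_comm' (t' := Finset.Icc a b) (s' := fun e => Finset.Icc a e) fun c e => ?_]
  · simp only [← Finset.sum_smul, IncidenceAlgebra.sum_Icc_mu_right, ite_smul, one_smul, zero_smul,
      Finset.sum_ite_eq, Finset.left_mem_Icc.2 h, if_true]
  · simp only [Finset.mem_Icc]
    exact ⟨fun ⟨hc, he⟩ => ⟨⟨hc.1, he.1⟩, hc.1.trans he.1, he.2⟩,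
      fun ⟨hc, he⟩ => ⟨⟨hc.1, hc.2.trans he.2⟩, hc.2, he.2⟩⟩

end Inversion

section InverseAutomorphism

variable {K : Type*} [CommRing K] {lam mu : YoungDiagram}

theorem adjoinVarEquiv_one_skewG_right (h : mu ≤ lam) :
    adjoinVarEquiv 1 (skewG K lam mu) = ∑ nu ∈ Finset.Icc mu lam, skewG K nu mu :=
  (adjoinVar_skewG_right h 1).trans (by simp only [one_pow, one_smul])

theorem adjoinVarEquiv_one_skewG_left (h : mu ≤ lam) :
    adjoinVarEquiv 1 (skewG K lam mu) = ∑ nu ∈ Finset.Icc mu lam, skewG K lam nu :=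
  (adjoinVar_skewG_left h 1).trans (by simp only [one_pow, one_smul])

open Classical in
theorem adjoinVarEquiv_one_symm_skewG_right (h : mu ≤ lam) :
    (adjoinVarEquiv 1).symm (skewG K lam mu) =
      ∑ nu ∈ Finset.Icc mu lam, IncidenceAlgebra.mu ℤ nu lam • skewG K nu mu := by
  rw [AlgEquiv.symm_apply_eq, map_sum, ← sum_Icc_mu_smul_sum_Icc_left ℤ h (skewG K · mu)]
  refine Finset.sum_congr rfl fun nu hnu => ?_
  rw [map_zsmul, adjoinVarEquiv_one_skewG_right (Finset.mem_Icc.1 hnu).1]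

open Classical in
theorem adjoinVarEquiv_one_symm_skewG_left (h : mu ≤ lam) :
    (adjoinVarEquiv 1).symm (skewG K lam mu) =
      ∑ nu ∈ Finset.Icc mu lam, IncidenceAlgebra.mu ℤ mu nu • skewG K lam nu := by
  rw [AlgEquiv.symm_apply_eq, map_sum, ← sum_Icc_mu_smul_sum_Icc_right ℤ h (skewG K lam)]
  refine Finset.sum_congr rfl fun nu hnu => ?_
  rw [map_zsmul, adjoinVarEquiv_one_skewG_left (Finset.mem_Icc.1 hnu).2]

open Classical in
theorem coe_mu_smul_skewG {kap nu : YoungDiagram} (h : mu ≤ lam) (hle : kap ≤ nu) :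
    ((IncidenceAlgebra.mu ℤ mu lam • skewG K nu kap : SymmFn K) : MvPowerSeries ℕ K) =
      if IsRookStrip lam mu then (-1) ^ (skewCells lam mu).card * dualGrothendieck K nu kap
        else 0 := by
  rw [mu_eq_rookSign, rookSign_apply h, AddSubgroupClass.coe_zsmul, coe_skewG hle, ite_smul,
    zero_smul, zsmul_eq_mul, Int.cast_pow, Int.cast_neg, Int.cast_one]

open Classical in
theorem coe_adjoinVarEquiv_one_symm_skewG_right (h : mu ≤ lam) :
    ((adjoinVarEquiv 1).symm (skewG K lam mu) : MvPowerSeries ℕ K) =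
      ∑ nu ∈ Finset.Icc mu lam with IsRookStrip lam nu,
        (-1) ^ (skewCells lam nu).card * dualGrothendieck K nu mu := by
  rw [adjoinVarEquiv_one_symm_skewG_right h, AddSubmonoidClass.coe_finsetSum, Finset.sum_filter]
  exact Finset.sum_congr rfl fun nu hnu =>
    coe_mu_smul_skewG (Finset.mem_Icc.1 hnu).2 (Finset.mem_Icc.1 hnu).1

open Classical in
theorem coe_adjoinVarEquiv_one_symm_skewG_left (h : mu ≤ lam) :
    ((adjoinVarEquiv 1).symm (skewG K lam mu) : MvPowerSeries ℕ K) =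
      ∑ nu ∈ Finset.Icc mu lam with IsRookStrip nu mu,
        (-1) ^ (skewCells nu mu).card * dualGrothendieck K lam nu := by
  rw [adjoinVarEquiv_one_symm_skewG_left h, AddSubmonoidClass.coe_finsetSum, Finset.sum_filter]
  exact Finset.sum_congr rfl fun nu hnu =>
    coe_mu_smul_skewG (Finset.mem_Icc.1 hnu).1 (Finset.mem_Icc.1 hnu).2

theorem coe_apply_skewG_bot_eq_sum_iff (L : SymmFn K →ₗ[K] SymmFn K) :
    (∀ lam, (L (skewG K lam ⊥) : MvPowerSeries ℕ K) =
      ∑ mu ∈ Finset.Icc ⊥ lam, dualGrothendieck K mu ⊥) ↔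
      L = (adjoinVarEquiv (1 : K)).toLinearMap := by
  have hcoe (lam : YoungDiagram) : ∑ mu ∈ Finset.Icc ⊥ lam, dualGrothendieck K mu ⊥ =
      (adjoinVarEquiv 1 (skewG K lam ⊥) : MvPowerSeries ℕ K) := by
    rw [adjoinVarEquiv_one_skewG_right bot_le, AddSubmonoidClass.coe_finsetSum]
    exact Finset.sum_congr rfl fun _ _ => (coe_skewG bot_le).symm
  simp only [hcoe]
  refine ⟨fun hL => LinearMap.ext_on_range span_skewG_bot fun lam => Subtype.ext (hL lam), ?_⟩
  rintro rfl lam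
  rfl

open Classical in
theorem constHom_skewG (h : mu ≤ lam) :
    constHom K (skewG K lam mu) = if mu = lam then 1 else 0 := by
  rw [constHom_apply, coeff_skewG h, colProd_zero, IncidenceAlgebra.one_apply, Nat.cast_ite,
    Nat.cast_one, Nat.cast_zero]

open Classical in
theorem hall_E_neg_one_skewG (h : mu ≤ lam) :
    hall (E (-1 : K)) (skewG K lam mu) = (IncidenceAlgebra.mu ℤ mu lam : K) := by
  rw [hall_E_neg, adjoinVarEquiv_one_symm_skewG_right h, map_sum, Finset.sum_eq_single mu]
  · rw [map_zsmul, constHom_skewG le_rfl, if_pos rfl, zsmul_one]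
  · intro nu hnu hne
    rw [map_zsmul, constHom_skewG (Finset.mem_Icc.1 hnu).1, if_neg hne.symm, smul_zero]
  · exact fun hmem => absurd (Finset.left_mem_Icc.2 h) hmem

open Classical in
theorem hall_E_neg_one_skewG_eq_ite (h : mu ≤ lam) :
    hall (E (-1 : K)) (skewG K lam mu) =
      if IsRookStrip lam mu then (-1) ^ (skewCells lam mu).card else 0 := by
  rw [hall_E_neg_one_skewG h, mu_eq_rookSign, rookSign_apply h]
  push_cast
  rfl

theorem hall_E_neg_one_skewG_bot (lam : YoungDiagram) : hall (E (-1 : K)) (skewG K lam ⊥) =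
    if lam.card = 0 then 1 else if lam.card = 1 then -1 else 0 := by
  classical
  rw [hall_E_neg_one_skewG_eq_ite bot_le, skewCells_bot, ← YoungDiagram.card]
  simp only [isRookStrip_bot_iff]
  rcases lam.card with _ | _ | n <;> simp

end InverseAutomorphism

end SymFun

end

open SymFun Classical in
theorem mainTheorem10 (K : Type*) [CommRing K] :
    ∃ hg : ∀ lam mu : YoungDiagram, mu ≤ lam → dualGrothendieck K lam mu ∈ SymmFn K,
      -- the pairing with `E(-1)` is a ring homomorphism
      (∃ φ : SymmFn K →ₐ[K] K, ∀ f : SymmFn K, φ f = hall (E (-1)) f) ∧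
      -- its values on skew dual stable Grothendieck polynomials
      (∀ (lam mu : YoungDiagram) (h : mu ≤ lam),
        hall (E (-1 : K)) ⟨dualGrothendieck K lam mu, hg lam mu h⟩ =
          if IsRookStrip lam mu then (-1) ^ (skewCells lam mu).card else 0) ∧
      -- in particular, its values on straight shapes
      (∀ lam : YoungDiagram,
        hall (E (-1 : K)) ⟨dualGrothendieck K lam ⊥, hg lam ⊥ bot_le⟩ =
          if lam.card = 0 then 1 else if lam.card = 1 then -1 else 0) ∧
      -- these values are those of the Möbius function of Young's lattice
      (∀ (lam mu : YoungDiagram) (h : mu ≤ lam),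
        IncidenceAlgebra.mu ℤ mu lam =
            (if IsRookStrip lam mu then (-1) ^ (skewCells lam mu).card else 0) ∧
          hall (E (-1 : K)) ⟨dualGrothendieck K lam mu, hg lam mu h⟩ =
            (IncidenceAlgebra.mu ℤ mu lam : K)) ∧
      -- the linear map `I` with `I(g_lam) = ∑ g_mu` exists, is unique and is a ring automorphism,
      -- and its inverse is a signed sum over rook strips
      (∃ I : SymmFn K ≃ₐ[K] SymmFn K,
        (∀ L : SymmFn K →ₗ[K] SymmFn K,
          (∀ lam : YoungDiagram,
            (L ⟨dualGrothendieck K lam ⊥, hg lam ⊥ bot_le⟩ : MvPowerSeries ℕ K) =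
              ∑ mu ∈ Finset.Icc ⊥ lam, dualGrothendieck K mu ⊥) ↔ L = I.toLinearMap) ∧
        ∀ (lam mu : YoungDiagram) (h : mu ≤ lam),
          (I.symm ⟨dualGrothendieck K lam mu, hg lam mu h⟩ : MvPowerSeries ℕ K) =
              ∑ nu ∈ Finset.Icc mu lam with IsRookStrip lam nu,
                (-1) ^ (skewCells lam nu).card * dualGrothendieck K nu mu ∧
          (I.symm ⟨dualGrothendieck K lam mu, hg lam mu h⟩ : MvPowerSeries ℕ K) =
              ∑ nu ∈ Finset.Icc mu lam with IsRookStrip nu mu,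
                (-1) ^ (skewCells nu mu).card * dualGrothendieck K lam nu) := by
  have hskew (lam mu : YoungDiagram) (h : mu ≤ lam) :
      (⟨dualGrothendieck K lam mu, dualGrothendieck_mem K lam mu h⟩ : SymmFn K) = skewG K lam mu :=
    (skewG_of_le h).symm
  refine ⟨dualGrothendieck_mem K, ⟨(constHom K).comp (adjoinVarEquiv 1).symm.toAlgHom,
    fun f => (hall_E_neg 1 f).symm⟩, fun lam mu h => ?_, fun lam => ?_,
    fun lam mu h => ⟨?_, ?_⟩, adjoinVarEquiv 1, fun L => ?_, fun lam mu h => ⟨?_, ?_⟩⟩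
  · rw [hskew lam mu h, hall_E_neg_one_skewG_eq_ite h]
  · rw [hskew lam ⊥ bot_le, hall_E_neg_one_skewG_bot]
  · rw [mu_eq_rookSign, rookSign_apply h]
  · rw [hskew lam mu h, hall_E_neg_one_skewG h]
  · simp only [hskew _ ⊥ bot_le, coe_apply_skewG_bot_eq_sum_iff]
  · rw [hskew lam mu h, coe_adjoinVarEquiv_one_symm_skewG_right h]
  · rw [hskew lam mu h, coe_adjoinVarEquiv_one_symm_skewG_left h]
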